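/- Let $d\in\mathbb N_0$, let $\mathbb D^d=\{z\in\mathbb C^d:|z_i|<1\ \text{for all } i\}$, and let $H^2=H^2(\mathbb D^d)$ be the Hardy space of all $f(z)=\sum_{\alpha\in\mathbb N_0^d}a_\alpha z^\alpha$ with $\sum_\alpha|a_\alpha|^2<\infty$, with inner product $\langle f,g\rangle_2=\sum_\alpha \hat f(\alpha)\overline{\hat g(\alpha)}$, where $\hat f(\alpha)$ denotes the Taylor coefficient at $0$. Let $M_{z_i}$ be multiplication by $z_i$ on $H^2$, let $$\mathcal L_c=\{L\in\mathcal B(H^2): L\ge 0,\ M_{z_i}^*LM_{z_i}\le L,\ i=1,\dots,d\},$$ and for $g\in H^2$ put $$\|g\|_*=\inf\{\langle L1,1\rangle_2^{1/2}: L\in\mathcal L_c,\ L\ge g\otimes g\},\qquad (g\otimes g)f=\langle f,g\rangle_2\,g ,$$ which is a norm on $H^2$. Let $(\mathcal{SA}_d)_*$ be the completion of $(H^2,\|\cdot\|_*)$. For holomorphic $f=\sum_\alpha a_\alpha z^\alpha$ on $\mathbb D^d$ let $\|f\|_{\mathrm{SA}}=\sup_{\mathbf T}\|f(\mathbf T)\|$,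 where $f(\mathbf T)=\sum_\alpha a_\alpha \mathbf T^\alpha$ and $\mathbf T$ runs over all commuting $d$-tuples of strict contractions ($\|T_i\|<1$) on complex Hilbert spaces, and let $\mathcal{SA}_d$ be the normed space of all holomorphic $f$ on $\mathbb D^d$ with $\|f\|_{\mathrm{SA}}<\infty$. Let $K_z(w)=\prod_{i=1}^d\frac1{1-w_i\bar z_i}$ for $z,w\in\mathbb D^d$. Then the Cauchy pairing $\langle g,f\rangle_2=\sum_\alpha\hat g(\alpha)\overline{\hat f(\alpha)}$ $(g\in H^2,\ f\in\mathcal{SA}_d)$ is well defined and extends to a duality between $(\mathcal{SA}_d)_*$ and $\mathcal{SA}_d$ for which $f\mapsto\langle\,\cdot\,,f\rangle$ is a conjugate linear isometric isomorphism of $\mathcal{SA}_d$ onto $((\mathcal{SA}_d)_*)^*$, and the following hold. (a) $(\mathcal{SA}_d)_*$ is a Banach space of analytic functions on $\mathbb D^d$ with continuous point evaluations: the inclusion of $H^2$ into the functions on $\mathbb D^d$ extends to an injective linear map from $(\mathcal{SA}_d)_*$ into the holomorphic functions on $\mathbb D^d$ such that evaluation at each $z\in\mathbb D^d$ is continuous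 on $(\mathcal{SA}_d)_*$. (b) With this identification, the polynomials $\mathbb C[z_1,\dots,z_d]$ and $\mathrm{span}\{K_z:z\in\mathbb D^d\}$ are contained in $(\mathcal{SA}_d)_*$ and each of them is dense. (c) Point evaluations at points of $\mathbb D^d$ are continuous in the weak-$*$ topology of $\mathcal{SA}_d$ given by the duality with $(\mathcal{SA}_d)_*$, and this is the only weak-$*$ topology on $\mathcal{SA}_d$ with this property: if $X$ is a complex Banach space and $\Psi:\mathcal{SA}_d\to X^*$ is a linear or conjugate linear homeomorphic isomorphism such that all evaluations at points of $\mathbb D^d$ are continuous for the topology on $\mathcal{SA}_d$ transported by $\Psi$ from the weak-$*$ topology of $X^*$, then that topology equals the one given by $(\mathcal{SA}_d)_*$. On bounded subsets of $\mathcal{SA}_d$, the weak-$*$ topology agrees with the topology of pointwise convergence on $\mathbb D^d$. (d) The polynomials are contained in $\mathcal{SA}_d$ and are weak-$*$ dense in $\mathcal{SA}_d$. -/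

import Mathlib

open scoped ENNReal ComplexConjugate InnerProduct

namespace SchurAglerDual

noncomputable section

open scoped ComplexOrder

/-! ### Functions on the polydisc -/

/-- The open unit polydisc `𝔻^d` in `ℂ^d`. -/
def polydisc (d : ℕ) : Set (Fin d → ℂ) := {z | ∀ i, ‖z i‖ < 1}

/-- The multi-indices `ℕ₀^d`. -/
abbrev MultiIndex (d : ℕ) : Type := Fin d →₀ ℕ

/-- `f` is the sum on `𝔻^d` of the (unconditionally convergent) power series `∑_α a_α z^α`. -/
def HasTaylor {d : ℕ} (a : MultiIndex d → ℂ) (f : polydisc d → ℂ) : Prop :=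
  ∀ z : polydisc d, HasSum (fun α => a α * ∏ i, (z : Fin d → ℂ) i ^ α i) (f z)

/-- `f` is holomorphic on `𝔻^d`: it is complex (Fréchet) differentiable there. Such a function is
automatically the sum of its Taylor series at `0` on all of `𝔻^d`; this is recorded
as the second field. -/
structure IsHolomorphic {d : ℕ} (f : polydisc d → ℂ) : Prop where
  differentiable : ∃ F : (Fin d → ℂ) → ℂ,
    DifferentiableOn ℂ F (polydisc d) ∧ ∀ z : polydisc d, F z = f z
  taylor : ∃ a : MultiIndex d → ℂ, HasTaylor a f

open Classical in
/-- The Taylor coefficients at `0` of a holomorphic function on `𝔻^d`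
(unique by `HasTaylor.unique`). -/
def taylorCoeff {d : ℕ} (f : polydisc d → ℂ) : MultiIndex d → ℂ :=
  if h : ∃ a : MultiIndex d → ℂ, HasTaylor a f then h.choose else 0

/-- The polynomial functions on `𝔻^d`. -/
def polyFunctions (d : ℕ) : Submodule ℂ (polydisc d → ℂ) where
  carrier := {f | ∃ p : MvPolynomial (Fin d) ℂ, ∀ z : polydisc d, f z = MvPolynomial.eval z.1 p}
  zero_mem' := ⟨0, by simp⟩
  add_mem' := by
    rintro f g ⟨p, hp⟩ ⟨q, hq⟩
    exact ⟨p + q, fun z => by simp [hp, hq]⟩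
  smul_mem' := by
    rintro c f ⟨p, hp⟩
    exact ⟨MvPolynomial.C c * p, fun z => by simp [hp]⟩

/-- The Szegő kernel function `K_z(w) = ∏ᵢ 1 / (1 - wᵢ z̄ᵢ)` of `𝔻^d`. -/
def szegoKernel {d : ℕ} (z : polydisc d) : polydisc d → ℂ :=
  fun w => ∏ i, 1 / (1 - w.1 i * conj (z.1 i))

/-- The linear span of the kernel functions. -/
def kernelSpan (d : ℕ) : Submodule ℂ (polydisc d → ℂ) := Submodule.span ℂ (Set.range szegoKernel)

/-! ### The Hardy space, multiplication by coordinates, and the dual Schur–Agler norm -/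

/-- The Hardy space `H²(𝔻^d)`, as the Hilbert space of square summable families of Taylor
coefficients `(a_α)`; such a family stands for the holomorphic function `∑_α a_α z^α`. -/
abbrev Hardy (d : ℕ) : Type := lp (fun _ : MultiIndex d => ℂ) 2

/-- The monomial `z^α` as an element of `H²(𝔻^d)`. -/
def hardyMonomial {d : ℕ} (α : MultiIndex d) : Hardy d := lp.single 2 α 1

/-- The coefficients of `zᵢ f`. -/
def shiftCoeff {d : ℕ} (i : Fin d) (a : MultiIndex d → ℂ) : MultiIndex d → ℂ :=
  fun α => if α i = 0 then 0 else a (α - Finsupp.single i 1)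

theorem shiftCoeff_add_single {d : ℕ} (i : Fin d) (a : MultiIndex d → ℂ) (α : MultiIndex d) :
    shiftCoeff i a (α + Finsupp.single i 1) = a α := by
  simp [shiftCoeff]

theorem hasSum_shiftCoeff {d : ℕ} (i : Fin d) (a : Hardy d) :
    HasSum (fun α => ‖shiftCoeff i a α‖ ^ (2 : ℝ≥0∞).toReal) (‖a‖ ^ (2 : ℝ≥0∞).toReal) := by
  have hinj : Function.Injective (fun α : MultiIndex d => α + Finsupp.single i 1) :=
    add_left_injective _
  refine (hinj.hasSum_iff ?_).1 ?_
  · intro α hα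
    have h0 : α i = 0 := by
      by_contra h
      refine hα ⟨α - Finsupp.single i 1, ?_⟩
      ext j
      by_cases hj : i = j
      · subst hj
        simp
        omega
      · simp [hj]
    simp [shiftCoeff, h0]
  · have := lp.hasSum_norm (p := 2) (by simp) a
    simpa [Function.comp_def, shiftCoeff_add_single] using this

/-- The operator `M_{zᵢ}` of multiplication by the coordinate `zᵢ` on `H²(𝔻^d)`
(an isometry). -/
def mulCoordIsometry {d : ℕ} (i : Fin d) : Hardy d →ₗᵢ[ℂ] Hardy d where
  toFun a := ⟨shiftCoeff i a, memℓp_gen (hasSum_shiftCoeff i a).summable⟩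
  map_add' a b := by
    ext α
    change shiftCoeff i (⇑a + ⇑b) α = shiftCoeff i a α + shiftCoeff i b α
    by_cases h : α i = 0 <;> simp [shiftCoeff, h]
  map_smul' c a := by
    ext α
    by_cases h : α i = 0 <;> simp [shiftCoeff, h]
  norm_map' a := by
    have h1 := (hasSum_shiftCoeff i a).tsum_eq
    have h2 := lp.norm_rpow_eq_tsum (p := 2) (by simp)
      (⟨shiftCoeff i a, memℓp_gen (hasSum_shiftCoeff i a).summable⟩ : Hardy d)
    have h3 := h2.trans h1
    refine (Real.rpow_left_inj (norm_nonneg _) (norm_nonneg _) (z := (2 : ℝ≥0∞).toReal)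
      (by simp)).1 h3

/-- The operator `M_{zᵢ}` as a bounded operator. -/
def mulCoord {d : ℕ} (i : Fin d) : Hardy d →L[ℂ] Hardy d :=
  (mulCoordIsometry i).toContinuousLinearMap

/-- The cone `𝓛_c` of all `L ≥ 0` on `H²(𝔻^d)` with `M_{zᵢ}^* L M_{zᵢ} ≤ L` for all `i`. -/
def coneLc (d : ℕ) : Set (Hardy d →L[ℂ] Hardy d) :=
  {L | 0 ≤ L ∧ ∀ i, (mulCoord i).adjoint ∘L L ∘L mulCoord i ≤ L}

/-- The set `𝓛_c(g)` of all `L ∈ 𝓛_c` with `L ≥ g ⊗ g`, where `(g ⊗ g) f = ⟨f, g⟩ g`. -/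
def coneLcAbove {d : ℕ} (g : Hardy d) : Set (Hardy d →L[ℂ] Hardy d) :=
  {L | L ∈ coneLc d ∧ InnerProductSpace.rankOne ℂ g g ≤ L}

/-- The number `⟨L 1, 1⟩` (real for `L ≥ 0`). -/
def vacuum {d : ℕ} (L : Hardy d →L[ℂ] Hardy d) : ℝ :=
  (inner ℂ (hardyMonomial 0) (L (hardyMonomial 0))).re

/-- The dual Schur–Agler norm `‖g‖_* = inf {⟨L 1, 1⟩^{1/2} : L ∈ 𝓛_c(g)}`. -/
def dualNorm {d : ℕ} (g : Hardy d) : ℝ := sInf ((fun L => √(vacuum L)) '' coneLcAbove g)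


/-! ### `‖·‖_*` is a norm -/

theorem adjoint_mulCoord_comp {d : ℕ} (i : Fin d) :
    (mulCoord i).adjoint ∘L mulCoord i = ContinuousLinearMap.id ℂ (Hardy d) := by
  refine ContinuousLinearMap.ext fun x => ext_inner_left ℂ fun y => ?_
  rw [ContinuousLinearMap.comp_apply, ContinuousLinearMap.adjoint_inner_right]
  exact (mulCoordIsometry i).inner_map_map y x

theorem mulCoord_monomial {d : ℕ} (i : Fin d) (α : MultiIndex d) :
    mulCoord i (hardyMonomial α) = hardyMonomial (α + Finsupp.single i 1) := by
  ext β
  change shiftCoeff i (hardyMonomial α) β = hardyMonomial (α + Finsupp.single i 1) β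
  by_cases h : ∃ γ, β = γ + Finsupp.single i 1
  · obtain ⟨γ, rfl⟩ := h
    rw [shiftCoeff_add_single]
    simp [hardyMonomial, Pi.single_apply]
  · have h0 : β i = 0 := by
      by_contra h'
      refine h ⟨β - Finsupp.single i 1, ?_⟩
      ext j
      by_cases hj : i = j
      · subst hj
        simp
        omega
      · simp [hj]
    have h1 : β ≠ α + Finsupp.single i 1 := fun h2 => h ⟨α, h2⟩
    simp [shiftCoeff, h0, hardyMonomial, h1]

theorem id_mem_coneLc (d : ℕ) : ContinuousLinearMap.id ℂ (Hardy d) ∈ coneLc d := by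
  refine ⟨(ContinuousLinearMap.nonneg_iff_isPositive _).2 ContinuousLinearMap.isPositive_id,
    fun i => ?_⟩
  rw [ContinuousLinearMap.id_comp, adjoint_mulCoord_comp]

theorem add_mem_coneLc {d : ℕ} {L M : Hardy d →L[ℂ] Hardy d} (hL : L ∈ coneLc d)
    (hM : M ∈ coneLc d) : L + M ∈ coneLc d := by
  simp only [coneLc, Set.mem_ofPred_eq, ContinuousLinearMap.le_def, sub_zero] at *
  refine ⟨hL.1.add hM.1, fun i => ?_⟩
  convert (hL.2 i).add (hM.2 i) using 1
  simp only [ContinuousLinearMap.add_comp, ContinuousLinearMap.comp_add]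
  abel

theorem smul_mem_coneLc {d : ℕ} {L : Hardy d →L[ℂ] Hardy d} (hL : L ∈ coneLc d)
    {c : ℝ} (hc : 0 ≤ c) : (c : ℂ) • L ∈ coneLc d := by
  simp only [coneLc, Set.mem_ofPred_eq, ContinuousLinearMap.le_def, sub_zero] at *
  have hc' : (0 : ℂ) ≤ (c : ℂ) := by exact_mod_cast hc
  refine ⟨hL.1.smul_of_nonneg hc', fun i => ?_⟩
  convert (hL.2 i).smul_of_nonneg hc' using 1
  simp only [ContinuousLinearMap.smul_comp, ContinuousLinearMap.comp_smul, smul_sub]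

theorem vacuum_add {d : ℕ} (L M : Hardy d →L[ℂ] Hardy d) :
    vacuum (L + M) = vacuum L + vacuum M := by
  simp [vacuum]

theorem vacuum_smul {d : ℕ} (c : ℝ) (L : Hardy d →L[ℂ] Hardy d) :
    vacuum ((c : ℂ) • L) = c * vacuum L := by
  rw [vacuum, smul_apply, inner_smul_right, Complex.re_ofReal_mul, vacuum]

theorem vacuum_nonneg {d : ℕ} {L : Hardy d →L[ℂ] Hardy d} (hL : L ∈ coneLc d) :
    0 ≤ vacuum L :=
  ((ContinuousLinearMap.nonneg_iff_isPositive L).1 hL.1).re_inner_nonneg_right (hardyMonomial 0)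

theorem smul_mem_coneLcAbove {d : ℕ} {g : Hardy d} {L : Hardy d →L[ℂ] Hardy d}
    (hL : L ∈ coneLcAbove g) (c : ℂ) : ((‖c‖ ^ 2 : ℝ) : ℂ) • L ∈ coneLcAbove (c • g) := by
  refine ⟨smul_mem_coneLc hL.1 (by positivity), ?_⟩
  have h := hL.2
  rw [ContinuousLinearMap.le_def] at h ⊢
  have hc : (0 : ℂ) ≤ ((‖c‖ ^ 2 : ℝ) : ℂ) := by exact_mod_cast sq_nonneg ‖c‖
  convert h.smul_of_nonneg hc using 1
  ext1 f
  simp only [sub_apply, smul_apply,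
    InnerProductSpace.rankOne_apply, inner_smul_left, smul_sub, smul_smul]
  rw [show (starRingEnd ℂ) c * inner ℂ g f * c = ((‖c‖ ^ 2 : ℝ) : ℂ) * inner ℂ g f by
    push_cast
    rw [← Complex.mul_conj']
    ring]

theorem add_mem_coneLcAbove {d : ℕ} {g h : Hardy d} {L M : Hardy d →L[ℂ] Hardy d}
    (hL : L ∈ coneLcAbove g) (hM : M ∈ coneLcAbove h) {s : ℝ} (hs : 0 < s) :
    ((1 + s : ℝ) : ℂ) • L + ((1 + s⁻¹ : ℝ) : ℂ) • M ∈ coneLcAbove (g + h) := by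
  refine ⟨add_mem_coneLc (smul_mem_coneLc hL.1 (by positivity))
    (smul_mem_coneLc hM.1 (by positivity)), ?_⟩
  have h1 := hL.2
  have h2 := hM.2
  rw [ContinuousLinearMap.le_def] at h1 h2 ⊢
  have c1 : (0 : ℂ) ≤ ((1 + s : ℝ) : ℂ) := by exact_mod_cast (by positivity : 0 ≤ 1 + s)
  have c2 : (0 : ℂ) ≤ ((1 + s⁻¹ : ℝ) : ℂ) := by exact_mod_cast (by positivity : 0 ≤ 1 + s⁻¹)
  have c3 : (0 : ℂ) ≤ ((s⁻¹ : ℝ) : ℂ) := by exact_mod_cast (by positivity : 0 ≤ s⁻¹)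
  have hs' : (s : ℂ) ≠ 0 := by exact_mod_cast hs.ne'
  have h3 := (InnerProductSpace.isPositive_rankOne_self (𝕜 := ℂ)
    ((s : ℂ) • g - h)).smul_of_nonneg c3
  convert ((h1.smul_of_nonneg c1).add (h2.smul_of_nonneg c2)).add h3 using 1
  ext1 f
  simp only [sub_apply, add_apply,
    smul_apply, InnerProductSpace.rankOne_apply, inner_smul_left,
    inner_add_left, inner_sub_left, Complex.conj_ofReal]
  push_cast
  match_scalars <;> field_simp <;> ring

theorem rankOne_le {d : ℕ} (g : Hardy d) :
    InnerProductSpace.rankOne ℂ g g ≤ ((‖g‖ ^ 2 : ℝ) : ℂ) • ContinuousLinearMap.id ℂ (Hardy d) := by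
  rw [ContinuousLinearMap.le_def, ContinuousLinearMap.isPositive_iff]
  constructor
  · have h1 : ((‖g‖ ^ 2 : ℝ) : ℂ) • ContinuousLinearMap.id ℂ (Hardy d)
        |>.IsPositive :=
      ContinuousLinearMap.isPositive_id.smul_of_nonneg (by exact_mod_cast sq_nonneg ‖g‖)
    exact h1.isSymmetric.sub (InnerProductSpace.isSymmetric_rankOne_self g)
  · intro f
    have e : inner ℂ ((((‖g‖ ^ 2 : ℝ) : ℂ) • ContinuousLinearMap.id ℂ (Hardy d)
        - InnerProductSpace.rankOne ℂ g g) f) f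
        = ((‖g‖ ^ 2 * ‖f‖ ^ 2 - ‖inner ℂ g f‖ ^ 2 : ℝ) : ℂ) := by
      simp only [sub_apply, smul_apply,
        ContinuousLinearMap.id_apply, InnerProductSpace.rankOne_apply, inner_sub_left,
        inner_smul_left, Complex.conj_ofReal, inner_self_eq_norm_sq_to_K]
      push_cast
      rw [← Complex.conj_mul']
      rfl
    rw [e]
    have := norm_inner_le_norm (𝕜 := ℂ) g f
    have h2 : ‖inner ℂ g f‖ ^ 2 ≤ ‖g‖ ^ 2 * ‖f‖ ^ 2 := by
      rw [← mul_pow]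
      gcongr
    exact_mod_cast sub_nonneg.2 h2

theorem coneLcAbove_nonempty {d : ℕ} (g : Hardy d) : (coneLcAbove g).Nonempty :=
  ⟨_, smul_mem_coneLc (id_mem_coneLc d) (sq_nonneg ‖g‖), rankOne_le g⟩

theorem dualNorm_le {d : ℕ} {g : Hardy d} {L : Hardy d →L[ℂ] Hardy d} (hL : L ∈ coneLcAbove g) :
    dualNorm g ≤ √(vacuum L) :=
  csInf_le ⟨0, by rintro _ ⟨L, -, rfl⟩; positivity⟩ ⟨L, hL, rfl⟩

theorem le_dualNorm {d : ℕ} {g : Hardy d} {c : ℝ}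
    (h : ∀ L ∈ coneLcAbove g, c ≤ √(vacuum L)) : c ≤ dualNorm g :=
  le_csInf ((coneLcAbove_nonempty g).image _) (by rintro _ ⟨L, hL, rfl⟩; exact h L hL)

theorem dualNorm_nonneg {d : ℕ} (g : Hardy d) : 0 ≤ dualNorm g :=
  le_dualNorm fun _ _ => Real.sqrt_nonneg _

theorem dualNorm_smul_le {d : ℕ} (c : ℂ) (g : Hardy d) :
    dualNorm (c • g) ≤ ‖c‖ * dualNorm g := by
  rcases eq_or_ne c 0 with rfl | hc
  · have h0 : (0 : Hardy d →L[ℂ] Hardy d) ∈ coneLcAbove (0 : Hardy d) := by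
      simp [coneLcAbove, coneLc]
    simpa [vacuum] using dualNorm_le h0
  · have hc' : 0 < ‖c‖ := norm_pos_iff.2 hc
    rw [← div_le_iff₀' hc']
    refine le_dualNorm fun L hL => ?_
    rw [div_le_iff₀' hc']
    refine (dualNorm_le (smul_mem_coneLcAbove hL c)).trans_eq ?_
    rw [vacuum_smul, Real.sqrt_mul (by positivity), Real.sqrt_sq hc'.le]

theorem dualNorm_smul {d : ℕ} (c : ℂ) (g : Hardy d) : dualNorm (c • g) = ‖c‖ * dualNorm g := by
  refine (dualNorm_smul_le c g).antisymm ?_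
  rcases eq_or_ne c 0 with rfl | hc
  · simpa using dualNorm_nonneg _
  · have h := dualNorm_smul_le c⁻¹ (c • g)
    rw [smul_smul, inv_mul_cancel₀ hc, one_smul, norm_inv] at h
    rwa [← le_inv_mul_iff₀ (norm_pos_iff.2 hc)]

theorem dualNorm_add_le {d : ℕ} (g h : Hardy d) :
    dualNorm (g + h) ≤ dualNorm g + dualNorm h := by
  rw [← sub_le_iff_le_add]
  refine le_dualNorm fun M hM => ?_
  rw [sub_le_comm]
  refine le_dualNorm fun L hL => ?_
  rw [sub_le_iff_le_add]
  refine le_of_forall_pos_le_add fun ε hε => ?_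
  set a := √(vacuum M) + ε / 2 with ha
  set b := √(vacuum L) + ε / 2 with hb
  have ha0 : 0 < a := by positivity
  have hb0 : 0 < b := by positivity
  have hM' : vacuum M ≤ a ^ 2 := by
    rw [← Real.sqrt_le_left ha0.le]
    linarith
  have hL' : vacuum L ≤ b ^ 2 := by
    rw [← Real.sqrt_le_left hb0.le]
    linarith
  have key := dualNorm_le (add_mem_coneLcAbove hM hL (s := b / a) (by positivity))
  rw [vacuum_add, vacuum_smul, vacuum_smul] at key
  have h1 : (1 + b / a) * vacuum M + (1 + (b / a)⁻¹) * vacuum L ≤ (a + b) ^ 2 := by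
    calc _ ≤ (1 + b / a) * a ^ 2 + (1 + (b / a)⁻¹) * b ^ 2 := by gcongr
      _ = (a + b) ^ 2 := by field_simp; ring
  have h2 := key.trans (Real.sqrt_le_sqrt h1)
  rw [Real.sqrt_sq (by positivity)] at h2
  linarith

theorem norm_coeff_le_dualNorm {d : ℕ} (g : Hardy d) (α : MultiIndex d) :
    ‖g α‖ ≤ dualNorm g := by
  refine le_dualNorm fun L hL => Real.le_sqrt_of_sq_le ?_
  have hdec : ∀ (i : Fin d) (β : MultiIndex d),
      (inner ℂ (L (hardyMonomial (β + Finsupp.single i 1)))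
        (hardyMonomial (β + Finsupp.single i 1))).re
      ≤ (inner ℂ (L (hardyMonomial β)) (hardyMonomial β)).re := by
    intro i β
    have h := (hL.1.2 i)
    rw [ContinuousLinearMap.le_def] at h
    have h2 := h.re_inner_nonneg_left (hardyMonomial β)
    rw [sub_apply, inner_sub_left, ContinuousLinearMap.comp_apply,
      ContinuousLinearMap.adjoint_inner_left, ContinuousLinearMap.comp_apply,
      mulCoord_monomial] at h2
    simpa using h2
  have hmono : ∀ β : MultiIndex d,
      (inner ℂ (L (hardyMonomial β)) (hardyMonomial β)).re ≤ vacuum L := by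
    have hadd : ∀ (i : Fin d) (n : ℕ) (β : MultiIndex d),
        (inner ℂ (L (hardyMonomial (β + Finsupp.single i n)))
          (hardyMonomial (β + Finsupp.single i n))).re
        ≤ (inner ℂ (L (hardyMonomial β)) (hardyMonomial β)).re := by
      intro i n
      induction n with
      | zero => intro β; simp
      | succ n ih =>
        intro β
        have := (hdec i (β + Finsupp.single i n)).trans (ih β)
        rwa [add_assoc, ← Finsupp.single_add] at this
    intro β
    induction β using Finsupp.induction with
    | zero =>
      have := ((ContinuousLinearMap.nonneg_iff_isPositive L).1 hL.1.1).inner_left_eq_inner_right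
        (hardyMonomial 0) (hardyMonomial 0)
      rw [this, vacuum]
    | single_add i n β _ _ ih =>
      rw [add_comm]
      exact (hadd i n β).trans ih
  refine le_trans ?_ (hmono α)
  have h := hL.2
  rw [ContinuousLinearMap.le_def] at h
  have h2 := h.re_inner_nonneg_left (hardyMonomial α)
  have h3 : inner ℂ g (hardyMonomial α) = conj (g α) := by
    rw [hardyMonomial, lp.inner_single_right]
    simp
  rw [sub_apply, inner_sub_left, InnerProductSpace.rankOne_apply, inner_smul_left, h3,
    Complex.conj_conj, Complex.mul_conj'] at h2
  have h4 : ((‖g α‖ : ℂ) ^ 2).re = ‖g α‖ ^ 2 := by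
    rw [← Complex.ofReal_pow, Complex.ofReal_re]
  simpa [h4] using h2

/-- The space `H²(𝔻^d)` carrying the norm `‖·‖_*`. -/
def HardyStar (d : ℕ) : Type := Hardy d

instance (d : ℕ) : AddCommGroup (HardyStar d) := inferInstanceAs (AddCommGroup (Hardy d))

instance (d : ℕ) : Module ℂ (HardyStar d) := inferInstanceAs (Module ℂ (Hardy d))

instance (d : ℕ) : Norm (HardyStar d) := ⟨fun g => dualNorm (d := d) g⟩

theorem hardyStar_core (d : ℕ) : NormedSpace.Core ℂ (HardyStar d) where
  norm_nonneg g := dualNorm_nonneg (d := d) g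
  norm_smul c g := dualNorm_smul (d := d) c g
  norm_triangle g h := dualNorm_add_le (d := d) g h
  norm_eq_zero_iff g := by
    constructor
    · intro hg
      refine lp.ext (funext fun α => ?_)
      have := norm_coeff_le_dualNorm (d := d) g α
      exact norm_le_zero_iff.1 (this.trans_eq hg)
    · rintro rfl
      have := dualNorm_smul (d := d) 0 0
      rw [zero_smul, norm_zero, zero_mul] at this
      exact this

instance (d : ℕ) : NormedAddCommGroup (HardyStar d) := .ofCore (hardyStar_core d)

instance (d : ℕ) : NormedSpace ℂ (HardyStar d) := .ofCore (hardyStar_core d)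

/-- The predual Schur–Agler space `(𝓢𝓐_d)_*`: the completion of `(H²(𝔻^d), ‖·‖_*)`. -/
abbrev Predual (d : ℕ) : Type := UniformSpace.Completion (HardyStar d)

/-- The canonical map of `H²(𝔻^d)` into its completion `(𝓢𝓐_d)_*`. -/
def toPredual {d : ℕ} (g : Hardy d) : Predual d := ((show HardyStar d from g) : Predual d)

/-! ### Uniqueness of Taylor coefficients -/

theorem powerSeries_unique {c : ℕ → ℂ}
    (h : ∀ t : ℂ, ‖t‖ < 1 → HasSum (fun n => c n * t ^ n) 0) : c = 0 := by
  have h1 : HasFPowerSeriesAt (fun _ : ℂ => (0 : ℂ))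
      (FormalMultilinearSeries.ofScalars ℂ c) 0 := by
    rw [hasFPowerSeriesAt_iff]
    filter_upwards [Metric.ball_mem_nhds (0 : ℂ) one_pos] with t ht
    have := h t (by simpa using ht)
    simpa [FormalMultilinearSeries.coeff_ofScalars, mul_comm] using this
  exact (FormalMultilinearSeries.ofScalars_series_eq_zero (E := ℂ) (c := c)).1 h1.eq_zero

theorem HasTaylor.eq_zero : ∀ {d : ℕ} {a : MultiIndex d → ℂ},
    HasTaylor a (0 : polydisc d → ℂ) → a = 0 := by
  intro d
  induction d with
  | zero =>
    intro a h
    funext α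
    have h0 := (hasSum_unique (fun β : MultiIndex 0 =>
      a β * ∏ i, (![] : Fin 0 → ℂ) i ^ β i)).unique (h ⟨![], fun i => i.elim0⟩)
    rw [Subsingleton.elim α default]
    simpa using h0
  | succ d ih =>
    intro a h
    let e : ℕ × MultiIndex d ≃ MultiIndex (d + 1) :=
      { toFun := fun p => Finsupp.cons p.1 p.2
        invFun := fun α => (α 0, α.tail)
        left_inv := fun p => by simp
        right_inv := fun α => by simp }
    have hs : ∀ (t : ℂ), ‖t‖ < 1 → ∀ z : polydisc d, HasSum (fun p : ℕ × MultiIndex d =>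
        a (Finsupp.cons p.1 p.2) * (t ^ p.1 * ∏ i, z.1 i ^ p.2 i)) 0 := by
      intro t ht z
      have hz : (Fin.cons t z.1 : Fin (d + 1) → ℂ) ∈ polydisc (d + 1) := by
        intro i
        refine Fin.cases ?_ (fun j => ?_) i
        · simpa using ht
        · simpa using z.2 j
      have := (e.hasSum_iff).2 (h ⟨_, hz⟩)
      simpa [e, Function.comp_def, Fin.prod_univ_succ] using this
    have hf : ∀ (n : ℕ) (z : polydisc d), Summable (fun β : MultiIndex d =>
        a (Finsupp.cons n β) * ∏ i, z.1 i ^ β i) := by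
      intro n z
      have := (hs (1 / 2) (by norm_num) z).summable.prod_factor n
      refine (summable_mul_left_iff (a := ((1 / 2 : ℂ)) ^ n) (by positivity)).1 ?_
      refine this.congr fun β => ?_
      ring
    have hc : ∀ (z : polydisc d) (n : ℕ),
        ∑' β : MultiIndex d, a (Finsupp.cons n β) * ∏ i, z.1 i ^ β i = 0 := by
      intro z n
      refine congrFun (powerSeries_unique
        (c := fun n => ∑' β : MultiIndex d, a (Finsupp.cons n β) * ∏ i, z.1 i ^ β i)
        fun t ht => ?_) n
      refine (hs t ht z).prod_fiberwise fun m => ?_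
      have := ((hf m z).hasSum).mul_right (t ^ m)
      refine this.congr_fun fun β => ?_
      ring
    funext α
    have := ih (a := fun β => a (Finsupp.cons (α 0) β)) fun z => by
      have := (hf (α 0) z).hasSum
      rwa [hc z (α 0)] at this
    simpa using congrFun this α.tail

theorem HasTaylor.add {d : ℕ} {a b : MultiIndex d → ℂ} {f g : polydisc d → ℂ}
    (hf : HasTaylor a f) (hg : HasTaylor b g) : HasTaylor (a + b) (f + g) := fun z => by
  simpa [add_mul] using (hf z).add (hg z)

theorem HasTaylor.smul {d : ℕ} {a : MultiIndex d → ℂ} {f : polydisc d → ℂ} (c : ℂ)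
    (hf : HasTaylor a f) : HasTaylor (c • a) (c • f) := fun z => by
  simpa [mul_assoc] using (hf z).mul_left c

theorem HasTaylor.unique {d : ℕ} {a b : MultiIndex d → ℂ} {f : polydisc d → ℂ}
    (ha : HasTaylor a f) (hb : HasTaylor b f) : a = b := by
  have h : HasTaylor (a + (-1 : ℂ) • b) (f + (-1 : ℂ) • f) := ha.add (hb.smul (-1))
  have h0 : f + (-1 : ℂ) • f = 0 := by simp
  rw [h0] at h
  have := h.eq_zero
  simpa [← sub_eq_add_neg, sub_eq_zero] using this

theorem HasTaylor.taylorCoeff_eq {d : ℕ} {a : MultiIndex d → ℂ} {f : polydisc d → ℂ}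
    (ha : HasTaylor a f) : taylorCoeff f = a := by
  have h : ∃ a : MultiIndex d → ℂ, HasTaylor a f := ⟨a, ha⟩
  rw [taylorCoeff, dif_pos h]
  exact h.choose_spec.unique ha

theorem IsHolomorphic.hasTaylor {d : ℕ} {f : polydisc d → ℂ} (hf : IsHolomorphic f) :
    HasTaylor (taylorCoeff f) f := by
  obtain ⟨a, ha⟩ := hf.taylor
  rwa [ha.taylorCoeff_eq]

theorem IsHolomorphic.zero {d : ℕ} : IsHolomorphic (0 : polydisc d → ℂ) :=
  ⟨⟨0, differentiableOn_const 0, fun _ => rfl⟩, ⟨0, fun z => by simp [hasSum_zero]⟩⟩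

theorem IsHolomorphic.add {d : ℕ} {f g : polydisc d → ℂ} (hf : IsHolomorphic f)
    (hg : IsHolomorphic g) : IsHolomorphic (f + g) := by
  obtain ⟨⟨F, hF, hFf⟩, ⟨a, ha⟩⟩ := hf
  obtain ⟨⟨G, hG, hGg⟩, ⟨b, hb⟩⟩ := hg
  exact ⟨⟨F + G, hF.add hG, fun z => by simp [hFf, hGg]⟩, ⟨_, ha.add hb⟩⟩

theorem IsHolomorphic.smul {d : ℕ} {f : polydisc d → ℂ} (c : ℂ) (hf : IsHolomorphic f) :
    IsHolomorphic (c • f) := by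
  obtain ⟨⟨F, hF, hFf⟩, ⟨a, ha⟩⟩ := hf
  exact ⟨⟨c • F, hF.const_smul c, fun z => by simp [hFf]⟩, ⟨_, ha.smul c⟩⟩

/-! ### The Schur–Agler norm and the Schur–Agler space -/

section FunctionalCalculus

variable {d : ℕ} {H : Type} [NormedAddCommGroup H] [InnerProductSpace ℂ H]

/-- The operator `T^α = T₁^{α₁} ⋯ T_d^{α_d}`. -/
def opMonomial (T : Fin d → H →L[ℂ] H) (α : MultiIndex d) : H →L[ℂ] H :=
  (List.ofFn fun i => T i ^ α i).prod

/-- The operator `f(T) = ∑_α a_α T^α`, where `∑_α a_α z^α` is the Taylor series of `f` at `0`. -/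
def opEval (f : polydisc d → ℂ) (T : Fin d → H →L[ℂ] H) : H →L[ℂ] H :=
  ∑' α, taylorCoeff f α • opMonomial T α

theorem norm_opMonomial_le (T : Fin d → H →L[ℂ] H) (α : MultiIndex d) :
    ‖opMonomial T α‖ ≤ ∏ i, ‖T i‖ ^ α i := by
  have hl : ∀ l : List (H →L[ℂ] H), ‖l.prod‖ ≤ (l.map norm).prod := by
    intro l
    induction l with
    | nil =>
      rw [List.prod_nil, List.map_nil, List.prod_nil]
      exact ContinuousLinearMap.norm_id_le
    | cons A l ih =>
      rw [List.prod_cons, List.map_cons, List.prod_cons]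
      exact (norm_mul_le _ _).trans (mul_le_mul_of_nonneg_left ih (norm_nonneg _))
  have hp : ∀ (A : H →L[ℂ] H) (n : ℕ), ‖A ^ n‖ ≤ ‖A‖ ^ n := by
    intro A n
    rcases Nat.eq_zero_or_pos n with rfl | hn
    · rw [pow_zero, pow_zero]
      exact ContinuousLinearMap.norm_id_le
    · exact norm_pow_le' A hn
  refine (hl _).trans ?_
  rw [List.map_ofFn, List.prod_ofFn]
  exact Finset.prod_le_prod (fun i _ => norm_nonneg _) fun i _ => hp _ _

theorem summable_opEval [CompleteSpace H] {f : polydisc d → ℂ} (hf : IsHolomorphic f)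
    {T : Fin d → H →L[ℂ] H} (hT : ∀ i, ‖T i‖ < 1) :
    Summable fun α => taylorCoeff f α • opMonomial T α := by
  have h := (hf.hasTaylor ⟨fun i => (‖T i‖ : ℂ), fun i => by simpa using hT i⟩).summable.norm
  refine Summable.of_norm_bounded h fun α => ?_
  rw [norm_smul, norm_mul, norm_prod]
  simpa using mul_le_mul_of_nonneg_left (norm_opMonomial_le T α) (norm_nonneg _)

theorem opEval_add [CompleteSpace H] {f g : polydisc d → ℂ} (hf : IsHolomorphic f)
    (hg : IsHolomorphic g) {T : Fin d → H →L[ℂ] H} (hT : ∀ i, ‖T i‖ < 1) :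
    opEval (f + g) T = opEval f T + opEval g T := by
  rw [opEval, opEval, opEval, ← (summable_opEval hf hT).tsum_add (summable_opEval hg hT),
    (hf.hasTaylor.add hg.hasTaylor).taylorCoeff_eq]
  simp [add_smul]

theorem opEval_smul [CompleteSpace H] (c : ℂ) {f : polydisc d → ℂ} (hf : IsHolomorphic f)
    {T : Fin d → H →L[ℂ] H} (hT : ∀ i, ‖T i‖ < 1) : opEval (c • f) T = c • opEval f T := by
  rw [opEval, opEval, ← (summable_opEval hf hT).tsum_const_smul c,
    (hf.hasTaylor.smul c).taylorCoeff_eq]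
  simp [smul_smul]

end FunctionalCalculus

/-- The Schur–Agler norm `‖f‖_SA ∈ [0, ∞]`: the supremum of `‖f(T)‖` over all commuting `d`-tuples
`T` of strict contractions on complex Hilbert spaces. (Cyclic tuples determine the supremum; they
live on separable spaces, so every Hilbert space is accounted for by those in `Type`.) -/
def saNorm {d : ℕ} (f : polydisc d → ℂ) : ℝ≥0∞ :=
  ⨆ (H : Type) (_ : NormedAddCommGroup H) (_ : InnerProductSpace ℂ H) (_ : CompleteSpace H)
    (T : Fin d → H →L[ℂ] H) (_ : ∀ i j, Commute (T i) (T j)) (_ : ∀ i, ‖T i‖ < 1), ‖opEval f T‖ₑ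

theorem saNorm_le {d : ℕ} {f : polydisc d → ℂ} {C : ℝ≥0∞}
    (h : ∀ (H : Type) [NormedAddCommGroup H] [InnerProductSpace ℂ H] [CompleteSpace H]
      (T : Fin d → H →L[ℂ] H), (∀ i j, Commute (T i) (T j)) → (∀ i, ‖T i‖ < 1) →
      ‖opEval f T‖ₑ ≤ C) : saNorm f ≤ C :=
  iSup_le fun H => iSup_le fun _ => iSup_le fun _ => iSup_le fun _ => iSup_le fun T =>
    iSup_le fun hc => iSup_le fun hT => h H T hc hT

theorem le_saNorm {d : ℕ} (f : polydisc d → ℂ) (H : Type) [i1 : NormedAddCommGroup H]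
    [i2 : InnerProductSpace ℂ H] [i3 : CompleteSpace H] (T : Fin d → H →L[ℂ] H)
    (hc : ∀ i j, Commute (T i) (T j)) (hT : ∀ i, ‖T i‖ < 1) : ‖opEval f T‖ₑ ≤ saNorm f :=
  le_iSup_of_le H <| le_iSup_of_le i1 <| le_iSup_of_le i2 <| le_iSup_of_le i3 <|
    le_iSup_of_le T <| le_iSup_of_le hc <| le_iSup_of_le hT le_rfl

theorem saNorm_add_le {d : ℕ} {f g : polydisc d → ℂ} (hf : IsHolomorphic f)
    (hg : IsHolomorphic g) : saNorm (f + g) ≤ saNorm f + saNorm g :=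
  saNorm_le fun H _ _ _ T hc hT => by
    rw [opEval_add hf hg hT]
    exact (enorm_add_le _ _).trans (add_le_add (le_saNorm f H T hc hT) (le_saNorm g H T hc hT))

theorem saNorm_smul_le {d : ℕ} (c : ℂ) {f : polydisc d → ℂ} (hf : IsHolomorphic f) :
    saNorm (c • f) ≤ ‖c‖ₑ * saNorm f :=
  saNorm_le fun H _ _ _ T hc hT => by
    rw [opEval_smul c hf hT, enorm_smul]
    gcongr
    exact le_saNorm f H T hc hT

/-- Evaluation at `z` is `f(T)` for the scalar tuple `T = z`, so `|f(z)| ≤ ‖f‖_SA`. -/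
theorem enorm_apply_le_saNorm {d : ℕ} {f : polydisc d → ℂ} (hf : IsHolomorphic f)
    (z : polydisc d) : ‖f z‖ₑ ≤ saNorm f := by
  let T : Fin d → ℂ →L[ℂ] ℂ := fun i => z.1 i • 1
  have hT : ∀ i, ‖T i‖ < 1 := fun i => by simpa [T, norm_smul] using z.2 i
  have hm : ∀ α : MultiIndex d, opMonomial T α = (∏ i, z.1 i ^ α i) • 1 := by
    intro α
    have : ∀ i, T i ^ α i = algebraMap ℂ (ℂ →L[ℂ] ℂ) (z.1 i ^ α i) := fun i => by
      rw [map_pow, Algebra.algebraMap_eq_smul_one]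
    rw [opMonomial, ← Algebra.algebraMap_eq_smul_one, ← List.prod_ofFn, map_list_prod,
      List.map_ofFn]
    simp only [this, Function.comp_def]
  have he : opEval f T = f z • (1 : ℂ →L[ℂ] ℂ) := by
    have h1 := (hf.hasTaylor z).smul_const (1 : ℂ →L[ℂ] ℂ)
    rw [opEval, ← h1.tsum_eq]
    exact tsum_congr fun α => by rw [hm, smul_smul]
  have h2 := le_saNorm f ℂ T (fun i j => by simp [T, Commute, SemiconjBy, smul_smul, mul_comm]) hT
  rwa [he, enorm_smul, show ‖(1 : ℂ →L[ℂ] ℂ)‖ₑ = 1 by simp, mul_one] at h2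

/-- The Schur–Agler space as a space of functions: all holomorphic `f : 𝔻^d → ℂ` with
`‖f‖_SA < ∞`. -/
def schurAglerSubmodule (d : ℕ) : Submodule ℂ (polydisc d → ℂ) where
  carrier := {f | IsHolomorphic f ∧ saNorm f < ∞}
  zero_mem' := ⟨.zero, lt_of_le_of_lt (saNorm_le (C := 0) fun H _ _ _ T hc hT => by
    rw [opEval, (HasTaylor.taylorCoeff_eq (a := 0) fun z => by simp [hasSum_zero])]
    simp) ENNReal.zero_lt_top⟩
  add_mem' hf hg := ⟨hf.1.add hg.1,
    (saNorm_add_le hf.1 hg.1).trans_lt (ENNReal.add_lt_top.2 ⟨hf.2, hg.2⟩)⟩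
  smul_mem' c _ hf := ⟨hf.1.smul c,
    (saNorm_smul_le c hf.1).trans_lt (ENNReal.mul_lt_top enorm_lt_top hf.2)⟩

/-- The Schur–Agler space `𝓢𝓐_d`, a normed space under `‖·‖_SA`. -/
def SchurAgler (d : ℕ) : Type := schurAglerSubmodule d

instance (d : ℕ) : CoeFun (SchurAgler d) (fun _ => polydisc d → ℂ) := ⟨fun f => f.1⟩

instance (d : ℕ) : AddCommGroup (SchurAgler d) :=
  inferInstanceAs (AddCommGroup (schurAglerSubmodule d))

instance (d : ℕ) : Module ℂ (SchurAgler d) :=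
  inferInstanceAs (Module ℂ (schurAglerSubmodule d))

instance (d : ℕ) : Norm (SchurAgler d) := ⟨fun f => (saNorm f).toReal⟩

theorem schurAgler_core (d : ℕ) : NormedSpace.Core ℂ (SchurAgler d) := by
  have hle : ∀ (c : ℂ) (f : SchurAgler d), ‖c • f‖ ≤ ‖c‖ * ‖f‖ := by
    intro c f
    have h := ENNReal.toReal_mono (ENNReal.mul_ne_top enorm_ne_top f.2.2.ne)
      (saNorm_smul_le c f.2.1)
    rw [ENNReal.toReal_mul, toReal_enorm] at h
    exact h
  refine ⟨⟨fun f => ENNReal.toReal_nonneg, fun c f => (hle c f).antisymm ?_, fun f g => ?_⟩,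
    fun f => ⟨fun hf => ?_, ?_⟩⟩
  · rcases eq_or_ne c 0 with rfl | hc
    · rw [norm_zero, zero_mul]
      exact ENNReal.toReal_nonneg
    · have h := hle c⁻¹ (c • f)
      rw [smul_smul, inv_mul_cancel₀ hc, one_smul, norm_inv] at h
      rwa [← le_inv_mul_iff₀ (norm_pos_iff.2 hc)]
  · have h := ENNReal.toReal_mono (ENNReal.add_ne_top.2 ⟨f.2.2.ne, g.2.2.ne⟩)
      (saNorm_add_le f.2.1 g.2.1)
    rw [ENNReal.toReal_add f.2.2.ne g.2.2.ne] at h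
    exact h
  · have h0 : saNorm f.1 = 0 := ((ENNReal.toReal_eq_zero_iff _).1 hf).resolve_right f.2.2.ne
    refine Subtype.ext (funext fun z => ?_)
    have := enorm_apply_le_saNorm f.2.1 z
    rw [h0] at this
    exact enorm_eq_zero.1 (le_antisymm this zero_le)
  · rintro rfl
    have h := hle 0 0
    rw [norm_zero, zero_mul, zero_smul] at h
    exact h.antisymm ENNReal.toReal_nonneg

instance (d : ℕ) : NormedAddCommGroup (SchurAgler d) := .ofCore (schurAgler_core d)

instance (d : ℕ) : NormedSpace ℂ (SchurAgler d) := .ofCore (schurAgler_core d)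

/-! ### Weak-star topologies on the Schur–Agler space -/

/-- The topology on `𝓢𝓐_d` transported from the weak-star topology `σ(X^*, X)` along a map
`Ψ : 𝓢𝓐_d → X^*` (used for identifications `Ψ` of `𝓢𝓐_d` with the dual of a Banach space). -/
abbrev weakStarTopology {d : ℕ} {X : Type*} [NormedAddCommGroup X] [NormedSpace ℂ X]
    (Ψ : SchurAgler d → StrongDual ℂ X) : TopologicalSpace (SchurAgler d) :=
  TopologicalSpace.induced (fun f => StrongDual.toWeakDual (Ψ f)) inferInstance

/-- All evaluations `f ↦ f(z)`, `z ∈ 𝔻^d`, are continuous in the topology `τ` on `𝓢𝓐_d`. -/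
def EvalContinuous {d : ℕ} (τ : TopologicalSpace (SchurAgler d)) : Prop :=
  ∀ z : polydisc d, @Continuous _ _ τ inferInstance (fun f : SchurAgler d => f z)

/-- The topology of pointwise convergence on `𝔻^d`, on `𝓢𝓐_d`. -/
abbrev pointwiseTopology (d : ℕ) : TopologicalSpace (SchurAgler d) :=
  TopologicalSpace.induced (fun (f : SchurAgler d) (z : polydisc d) => f z) inferInstance

end

end SchurAglerDual

open SchurAglerDual

namespace SchurAglerDual

noncomputable section

open Filter Topology

open scoped ComplexOrder

/-! ### Power series with bounded coefficients -/

/-! The heart is the identity `‖f‖_SA = sup |⟨g, f⟩| / ‖g‖_*` over nonzero `g` in `H²`; both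
inequalities translate between operators in the cone and commuting contractions.

Upper bound (`exists_hilbert_model`, `norm_dilated_pairing_le`): for `L ∈ 𝓛_c(g)`, complete `H²` in
the form `⟨L u, v⟩`. Multiplication by the coordinates becomes a commuting tuple `T` of
contractions, `⟨·, g⟩` becomes a functional `φ` of norm at most one, and the vector `e(1)` has norm
`⟨L 1, 1⟩^{1/2}`. The pairing with the dilate `f(r ·)` is, up to conjugation, `φ(f(rT) e(1))`, hence
at most `‖f‖_SA ⟨L 1, 1⟩^{1/2}`; take the infimum over `L` and let `r → 1`.

Lower bound (`saNorm_le_of_norm_inner_le`): for strict commuting contractions `T` and a vector `x`,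
let `A u = u(T) x` and `y = f(T) x`. Then `‖y‖² A*A` lies in `𝓛_c(A* y)`, so `‖A* y‖_* ≤ ‖y‖ ‖x‖`,
while pairing `f` with `A* y` gives `‖y‖²`. Surjectivity onto the dual follows by Riesz
representation, since `‖·‖_* ≤ ‖·‖` on `H²`.

Elements of the completion are functions because Taylor coefficients are `‖·‖_*`-bounded.
Injectivity uses dilations: they are `‖·‖_*`-contractive, tend strongly to the identity, and for `r
< 1` are determined by the coefficients. Applied in the dual, they also give weak-star density of
polynomials.

The functionals `f ↦ f(z)` come from the kernels `K_z`, whose span is dense in the predual. Any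
other predual with continuous evaluations contains a corresponding total family, and matching the
two families identifies the two sets of functionals and so the topologies. -/

/-- Induction on the number of variables: splitting off the first exponent gives a product of a
geometric series and the sum in the remaining variables. -/
theorem hasSum_prod_pow {𝕜 : Type*} [NormedField 𝕜] [CompleteSpace 𝕜] :
    ∀ {d : ℕ} (w : Fin d → 𝕜), (∀ i, ‖w i‖ < 1) →
      (Summable fun α : MultiIndex d => ‖∏ i, w i ^ α i‖) ∧
        HasSum (fun α : MultiIndex d => ∏ i, w i ^ α i) (∏ i, (1 - w i)⁻¹) := by
  intro d
  induction d with
  | zero =>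
    intro w _
    have h : HasSum (fun α : MultiIndex 0 => ∏ i, w i ^ α i) (∏ i, (1 - w i)⁻¹) := by
      simp
    exact ⟨(hasSum_unique _).summable, h⟩
  | succ d ih =>
    intro w hw
    let e : ℕ × MultiIndex d ≃ MultiIndex (d + 1) :=
      { toFun := fun p => Finsupp.cons p.1 p.2
        invFun := fun α => (α 0, α.tail)
        left_inv := fun p => by simp
        right_inv := fun α => by simp }
    obtain ⟨h1, h2⟩ := ih (fun i => w i.succ) fun i => hw i.succ
    have h3 : Summable fun n : ℕ => ‖w 0 ^ n‖ := by
      simpa using summable_geometric_of_lt_one (norm_nonneg _) (hw 0)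
    have h4 := hasSum_geometric_of_norm_lt_one (hw 0)
    have h5 : Summable fun p : ℕ × MultiIndex d => ‖w 0 ^ p.1 * ∏ i : Fin d, w i.succ ^ p.2 i‖ :=
      Summable.mul_norm (f := fun n : ℕ => w 0 ^ n)
        (g := fun α : MultiIndex d => ∏ i : Fin d, w i.succ ^ α i) h3 h1
    constructor
    · refine (e.summable_iff).1 ?_
      simpa [e, Function.comp_def, Fin.prod_univ_succ] using h5
    · refine (e.hasSum_iff).1 ?_
      have := h4.mul h2 h5.of_norm
      rw [← Fin.prod_univ_succ (fun i => (1 - w i)⁻¹)] at this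
      simpa only [e, Function.comp_def, Fin.prod_univ_succ (fun i => w i ^ _),
        Equiv.coe_fn_mk, Finsupp.cons_zero, Finsupp.cons_succ] using this

theorem polydisc_eq_ball (d : ℕ) : polydisc d = Metric.ball 0 1 := by
  ext z
  simp [polydisc, pi_norm_lt_iff]

theorem norm_prod_pow_le {d : ℕ} {z : Fin d → ℂ} {ρ : ℝ} (hz : ‖z‖ ≤ ρ) (α : MultiIndex d) :
    ‖∏ i, z i ^ α i‖ ≤ ρ ^ α.degree := by
  rw [norm_prod, Finsupp.degree_eq_sum, ← Finset.prod_pow_eq_pow_sum]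
  refine Finset.prod_le_prod (fun i _ => norm_nonneg _) fun i _ => ?_
  rw [norm_pow]
  exact pow_le_pow_left₀ (norm_nonneg _) ((norm_le_pi_norm z i).trans hz) _

theorem summable_pow_degree {d : ℕ} {ρ : ℝ} (h0 : 0 ≤ ρ) (h1 : ρ < 1) :
    Summable fun α : MultiIndex d => ρ ^ α.degree := by
  have := (hasSum_prod_pow (fun _ : Fin d => ρ) fun i => by
    rwa [Real.norm_of_nonneg h0]).2.summable
  refine this.congr fun α => ?_
  rw [Finsupp.degree_eq_sum, ← Finset.prod_pow_eq_pow_sum]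

theorem differentiable_prod_pow {d : ℕ} (α : MultiIndex d) :
    Differentiable ℂ fun z : Fin d → ℂ => ∏ i, z i ^ α i := by
  fun_prop

/-- Cauchy's estimate on the circle of radius `s` in each unit direction `v`; all points `z + t v`
on it have norm at most `ρ + s`. -/
theorem norm_fderiv_prod_pow_le {d : ℕ} {z : Fin d → ℂ} {ρ s : ℝ} (hs : 0 < s) (hz : ‖z‖ ≤ ρ)
    (α : MultiIndex d) :
    ‖fderiv ℂ (fun z : Fin d → ℂ => ∏ i, z i ^ α i) z‖ ≤ (ρ + s) ^ α.degree / s := by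
  have hρ : 0 ≤ ρ := (norm_nonneg z).trans hz
  refine ContinuousLinearMap.opNorm_le_of_unit_norm (by positivity) fun v hv => ?_
  have h1 : HasDerivAt (fun t : ℂ => z + t • v) v 0 := by
    simpa using ((hasDerivAt_id (0 : ℂ)).smul_const v).const_add z
  have h2 : HasDerivAt (fun t : ℂ => ∏ i, (z + t • v) i ^ α i)
      (fderiv ℂ (fun z : Fin d → ℂ => ∏ i, z i ^ α i) z v) 0 := by
    refine HasFDerivAt.comp_hasDerivAt (𝕜 := ℂ)
      (l := fun z : Fin d → ℂ => ∏ i, z i ^ α i) (0 : ℂ) ?_ h1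
    simpa using (differentiable_prod_pow α z).hasFDerivAt
  rw [← h2.deriv]
  refine Complex.norm_deriv_le_of_forall_mem_sphere_norm_le hs ?_ fun t ht => ?_
  · refine Differentiable.diffContOnCl ?_
    fun_prop
  · refine norm_prod_pow_le ((norm_add_le _ _).trans ?_) α
    rw [norm_smul, hv, mul_one, mem_sphere_zero_iff_norm.1 ht]
    gcongr

theorem hasTaylor_of_bounded {d : ℕ} {a : MultiIndex d → ℂ} {C : ℝ} (ha : ∀ α, ‖a α‖ ≤ C) :
    HasTaylor a fun z => ∑' α, a α * ∏ i, (z : Fin d → ℂ) i ^ α i := by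
  intro z
  refine Summable.hasSum (Summable.of_norm_bounded
    ((hasSum_prod_pow z.1 z.2).1.mul_left C) fun α => ?_)
  rw [norm_mul]
  exact mul_le_mul_of_nonneg_right (ha α) (norm_nonneg _)

theorem isHolomorphic_of_bounded {d : ℕ} {a : MultiIndex d → ℂ} {C : ℝ} (ha : ∀ α, ‖a α‖ ≤ C) :
    IsHolomorphic fun z : polydisc d => ∑' α, a α * ∏ i, (z : Fin d → ℂ) i ^ α i := by
  refine ⟨⟨fun z => ∑' α, a α * ∏ i, z i ^ α i, fun z hz => ?_, fun z => rfl⟩,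
    ⟨a, hasTaylor_of_bounded ha⟩⟩
  refine DifferentiableAt.differentiableWithinAt ?_
  have hC : 0 ≤ C := (norm_nonneg _).trans (ha 0)
  rw [polydisc_eq_ball, mem_ball_zero_iff] at hz
  -- Two radii `‖z‖ < ρ < ρ' < 1`: differentiation is termwise on the `ρ`-ball, and Cauchy estimates
  -- with circles of radius `ρ' - ρ` keep the derivative series summable.
  obtain ⟨ρ, hzρ, hρ⟩ := exists_between hz
  obtain ⟨ρ', hρρ', hρ'⟩ := exists_between hρ
  have hρ0 : 0 < ρ := (norm_nonneg z).trans_lt hzρ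
  have hu : Summable fun α : MultiIndex d => C * (ρ' ^ α.degree / (ρ' - ρ)) :=
    ((summable_pow_degree (hρ0.trans hρρ').le hρ').div_const _).mul_left C
  refine (hasFDerivAt_tsum_of_isPreconnected (𝕜 := ℂ) hu (s := Metric.ball 0 ρ) (x₀ := z)
    (f := fun α (z : Fin d → ℂ) => a α * ∏ i, z i ^ α i)
    (f' := fun α z => a α • fderiv ℂ (fun z : Fin d → ℂ => ∏ i, z i ^ α i) z)
    Metric.isOpen_ball (convex_ball _ _).isPreconnected
    (fun α x _ => (differentiable_prod_pow α x).hasFDerivAt.const_mul (a α))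
    (fun α x hx => ?_) (by simpa using hzρ) ?_ (by simpa using hzρ)).differentiableAt
  · rw [norm_smul]
    have := norm_fderiv_prod_pow_le (sub_pos.2 hρρ') (mem_ball_zero_iff.1 hx).le α
    rw [add_sub_cancel] at this
    exact mul_le_mul (ha α) this (norm_nonneg _) hC
  · refine (hasTaylor_of_bounded ha ⟨z, ?_⟩).summable
    rwa [polydisc_eq_ball, mem_ball_zero_iff]

theorem hasTaylor_szegoKernel {d : ℕ} (z : polydisc d) :
    HasTaylor (fun α => ∏ i, conj (z.1 i) ^ α i) (szegoKernel z) := by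
  intro w
  have h := (hasSum_prod_pow (fun i => w.1 i * conj (z.1 i)) fun i => by
    rw [norm_mul, RCLike.norm_conj]
    exact mul_lt_one_of_nonneg_of_lt_one_left (norm_nonneg _) (w.2 i) (z.2 i).le).2
  simpa [szegoKernel, mul_pow, Finset.prod_mul_distrib, mul_comm] using h

/-! ### Monomials in commuting operators -/

/-- The products are ordered, so raising an exponent needs commutativity: the extra factor is moved
left past the power of `T 0`, inductively in the number of factors. -/
theorem prod_ofFn_pow_add_single {M : Type*} [Monoid M] : ∀ {d : ℕ} (T : Fin d → M),
    (∀ i j, Commute (T i) (T j)) → ∀ (α : Fin d → ℕ) (i : Fin d),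
    (List.ofFn fun j => T j ^ (α j + (Pi.single i 1 : Fin d → ℕ) j)).prod =
      T i * (List.ofFn fun j => T j ^ α j).prod := by
  intro d
  induction d with
  | zero => exact fun _ _ _ i => i.elim0
  | succ d ih =>
    intro T hT α i
    rw [List.ofFn_succ, List.prod_cons, List.ofFn_succ, List.prod_cons]
    refine Fin.cases ?_ (fun k => ?_) i
    · simp [pow_succ', mul_assoc]
    · have h := ih (fun j => T j.succ) (fun a b => hT _ _) (fun j => α j.succ) k
      have h1 : ∀ j : Fin d, (Pi.single k.succ 1 : Fin (d + 1) → ℕ) j.succ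
          = (Pi.single k 1 : Fin d → ℕ) j := fun j => by
        simp [Pi.single_apply]
      simp only [h1, h]
      rw [Pi.single_eq_of_ne (Fin.succ_ne_zero k).symm, add_zero, ← mul_assoc, ← mul_assoc,
        ((hT k.succ 0).pow_right (α 0)).eq]

section Operators

variable {d : ℕ} {H : Type} [NormedAddCommGroup H] [InnerProductSpace ℂ H]

theorem opMonomial_zero (T : Fin d → H →L[ℂ] H) : opMonomial T 0 = 1 := by
  simp [opMonomial]

theorem opMonomial_add_single {T : Fin d → H →L[ℂ] H} (hT : ∀ i j, Commute (T i) (T j))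
    (α : MultiIndex d) (i : Fin d) :
    opMonomial T (α + Finsupp.single i 1) = T i * opMonomial T α := by
  have := prod_ofFn_pow_add_single T hT α i
  simpa [opMonomial, Finsupp.single_eq_pi_single] using this

/-- Induction over multi-indices, raising one coordinate at a time. -/
theorem MultiIndex.induction {p : MultiIndex d → Prop} (h0 : p 0)
    (h1 : ∀ α i, p α → p (α + Finsupp.single i 1)) (α : MultiIndex d) : p α := by
  induction α using Finsupp.induction with
  | zero => exact h0
  | single_add i n β _ _ ih =>
    rw [add_comm]
    clear * - ih h1
    induction n with
    | zero => simpa using ih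
    | succ n hn =>
      rw [Finsupp.single_add, ← add_assoc]
      exact h1 _ _ hn

theorem opMonomial_smul {T : Fin d → H →L[ℂ] H} (hT : ∀ i j, Commute (T i) (T j)) (r : ℂ)
    (α : MultiIndex d) :
    opMonomial (fun i => r • T i) α = r ^ α.degree • opMonomial T α := by
  induction α using MultiIndex.induction with
  | h0 => simp [opMonomial_zero]
  | h1 α i ih =>
    rw [opMonomial_add_single (fun i j => ((hT i j).smul_left r).smul_right r),
      opMonomial_add_single hT, ih, smul_mul_smul_comm, map_add, Finsupp.degree_single, pow_succ']

theorem norm_opMonomial_le_pow {T : Fin d → H →L[ℂ] H} {ρ : ℝ} (hT : ∀ i, ‖T i‖ ≤ ρ)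
    (α : MultiIndex d) : ‖opMonomial T α‖ ≤ ρ ^ α.degree := by
  refine (norm_opMonomial_le T α).trans ?_
  rw [Finsupp.degree_eq_sum, ← Finset.prod_pow_eq_pow_sum]
  exact Finset.prod_le_prod (fun i _ => by positivity) fun i _ =>
    pow_le_pow_left₀ (norm_nonneg _) (hT i) _

end Operators

/-! ### The dilations `g ↦ g(r ·)` of the Hardy space -/

theorem memℓp_of_norm_le {ι : Type*} {a b : ι → ℂ} (hb : Memℓp b 2) (h : ∀ i, ‖a i‖ ≤ ‖b i‖) :
    Memℓp a 2 :=
  memℓp_gen (((memℓp_gen_iff (by simp)).1 hb).of_nonneg_of_le (fun i => by positivity)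
    fun i => Real.rpow_le_rpow (norm_nonneg _) (h i) (by simp))

theorem inner_monomial_left {d : ℕ} (α : MultiIndex d) (g : Hardy d) :
    inner ℂ (hardyMonomial α) g = g α := by
  rw [hardyMonomial, lp.inner_single_left]
  simp

theorem inner_monomial_right {d : ℕ} (α : MultiIndex d) (g : Hardy d) :
    inner ℂ g (hardyMonomial α) = conj (g α) := by
  rw [← inner_monomial_left, inner_conj_symm]

theorem hasSum_hardyMonomial {d : ℕ} (g : Hardy d) :
    HasSum (fun α => g α • hardyMonomial α) g := by
  have := lp.hasSum_single (p := 2) (by simp) g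
  refine this.congr_fun fun α => ?_
  rw [hardyMonomial, ← lp.single_smul, smul_eq_mul, mul_one]

theorem hardy_norm_sq {d : ℕ} (g : Hardy d) : HasSum (fun α => ‖g α‖ ^ 2) (‖g‖ ^ 2) := by
  have := lp.hasSum_norm (p := 2) (by simp) g
  simpa using this

theorem norm_hardyMonomial {d : ℕ} (α : MultiIndex d) : ‖hardyMonomial α‖ = 1 := by
  rw [hardyMonomial, lp.norm_single (by simp), norm_one]

theorem pow_mem_unitInterval {r : unitInterval} (n : ℕ) :
    ‖((r : ℝ) : ℂ) ^ n‖ ≤ 1 := by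
  rw [norm_pow, Complex.norm_real, Real.norm_of_nonneg r.2.1]
  exact pow_le_one₀ r.2.1 r.2.2

/-- The dilation `g ↦ g(r ·)` of the Hardy space. -/
def dilation (d : ℕ) (r : unitInterval) : Hardy d →L[ℂ] Hardy d :=
  LinearMap.mkContinuous
    { toFun := fun g => ⟨fun α => ((r : ℝ) : ℂ) ^ α.degree * g α,
        memℓp_of_norm_le (lp.memℓp g) fun α => by
          rw [norm_mul]
          exact mul_le_of_le_one_left (norm_nonneg _) (pow_mem_unitInterval _)⟩
      map_add' := fun g h => lp.ext (funext fun α => mul_add _ _ _)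
      map_smul' := fun c g => lp.ext (funext fun α => mul_left_comm _ _ _) }
    1 fun g => by
      rw [one_mul]
      refine lp.norm_mono (by simp) fun α => ?_
      change ‖((r : ℝ) : ℂ) ^ α.degree * g α‖ ≤ _
      rw [norm_mul]
      exact mul_le_of_le_one_left (norm_nonneg _) (pow_mem_unitInterval _)

theorem dilation_apply {d : ℕ} (r : unitInterval) (g : Hardy d) (α : MultiIndex d) :
    dilation d r g α = ((r : ℝ) : ℂ) ^ α.degree * g α := rfl

theorem dilation_monomial {d : ℕ} (r : unitInterval) (α : MultiIndex d) :
    dilation d r (hardyMonomial α) = ((r : ℝ) : ℂ) ^ α.degree • hardyMonomial α := by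
  ext β
  rw [dilation_apply, lp.coeFn_smul, Pi.smul_apply, smul_eq_mul]
  by_cases h : β = α
  · rw [h]
  · simp [hardyMonomial, h]

theorem inner_dilation {d : ℕ} (r : unitInterval) (g h : Hardy d) :
    inner ℂ (dilation d r g) h = inner ℂ g (dilation d r h) := by
  rw [lp.inner_eq_tsum, lp.inner_eq_tsum]
  refine tsum_congr fun α => ?_
  simp only [dilation_apply, RCLike.inner_apply, map_mul, map_pow, Complex.conj_ofReal]
  ring

theorem dilation_mulCoord {d : ℕ} (r : unitInterval) (i : Fin d) (g : Hardy d) :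
    dilation d r (mulCoord i g) = ((r : ℝ) : ℂ) • mulCoord i (dilation d r g) := by
  ext β
  rw [dilation_apply, lp.coeFn_smul, Pi.smul_apply, smul_eq_mul]
  change _ * shiftCoeff i g β = _ * shiftCoeff i (dilation d r g) β
  by_cases h0 : β i = 0
  · simp [shiftCoeff, h0]
  · obtain ⟨γ, rfl⟩ : ∃ γ, β = γ + Finsupp.single i 1 := by
      refine ⟨β - Finsupp.single i 1, ?_⟩
      ext j
      by_cases hj : i = j
      · subst hj
        simp
        omega
      · simp [hj]
    rw [shiftCoeff_add_single, shiftCoeff_add_single, dilation_apply, map_add,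
      Finsupp.degree_single, pow_succ', mul_assoc]

/-- Nonnegativity in `ℂ` includes being real, so over complex scalars the quadratic form alone
forces symmetry. -/
theorem nonneg_inner_iff {d : ℕ} {L : Hardy d →L[ℂ] Hardy d} :
    0 ≤ L ↔ ∀ u, 0 ≤ inner ℂ u (L u) := by
  rw [ContinuousLinearMap.nonneg_iff_isPositive]
  constructor
  · exact fun h u => h.inner_nonneg_right u
  · intro h
    rw [ContinuousLinearMap.isPositive_iff_complex]
    intro u
    have h1 := h u
    rw [← inner_conj_symm, RCLike.star_def.symm, star_nonneg_iff] at h1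
    rw [RCLike.nonneg_iff] at h1
    exact ⟨RCLike.conj_eq_iff_re.1 (RCLike.conj_eq_iff_im.2 h1.2), h1.1⟩

theorem le_iff_inner {d : ℕ} {L M : Hardy d →L[ℂ] Hardy d} :
    L ≤ M ↔ ∀ u, inner ℂ u (L u) ≤ inner ℂ u (M u) := by
  rw [← sub_nonneg, nonneg_inner_iff]
  simp

theorem inner_rankOne_self {d : ℕ} (g u : Hardy d) :
    inner ℂ u (InnerProductSpace.rankOne ℂ g g u) = ((‖inner ℂ g u‖ ^ 2 : ℝ) : ℂ) := by
  rw [InnerProductSpace.rankOne_apply, inner_smul_right, ← inner_conj_symm u g]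
  rw [Complex.mul_conj']
  push_cast
  rfl

theorem mem_coneLcAbove_iff {d : ℕ} {g : Hardy d} {L : Hardy d →L[ℂ] Hardy d} :
    L ∈ coneLcAbove g ↔ (∀ u, 0 ≤ inner ℂ u (L u)) ∧
      (∀ i u, inner ℂ (mulCoord i u) (L (mulCoord i u)) ≤ inner ℂ u (L u)) ∧
      ∀ u, ((‖inner ℂ g u‖ ^ 2 : ℝ) : ℂ) ≤ inner ℂ u (L u) := by
  simp only [coneLcAbove, coneLc, Set.mem_ofPred_eq, le_iff_inner, zero_apply, inner_zero_right,
    inner_rankOne_self, and_assoc, ContinuousLinearMap.comp_apply,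
    ContinuousLinearMap.adjoint_inner_right]

/-- Conjugating by the self-adjoint dilation `D` sends `L ∈ 𝓛_c(g)` to `D L D ∈ 𝓛_c(D g)`. Moving
`D` past a coordinate multiplication costs a factor `r` on each side, harmless as `r² ≤ 1`, and `D`
fixes `1`, so the vacuum value is unchanged. -/
theorem dualNorm_dilation_le {d : ℕ} (r : unitInterval) (g : Hardy d) :
    dualNorm (dilation d r g) ≤ dualNorm g := by
  refine le_dualNorm fun L hL => ?_
  have hL' : dilation d r ∘L L ∘L dilation d r ∈ coneLcAbove (dilation d r g) := by
    rw [mem_coneLcAbove_iff] at hL ⊢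
    simp only [ContinuousLinearMap.comp_apply, ← inner_dilation]
    refine ⟨fun u => hL.1 _, fun i u => ?_, fun u => ?_⟩
    · rw [dilation_mulCoord, map_smul, inner_smul_left, inner_smul_right, Complex.conj_ofReal,
        ← mul_assoc]
      have h1 := hL.1 (mulCoord i (dilation d r u))
      have h2 : ((r : ℝ) : ℂ) * ((r : ℝ) : ℂ) ≤ 1 := by
        exact_mod_cast mul_le_one₀ r.2.2 r.2.1 r.2.2
      exact (mul_le_of_le_one_left h1 h2).trans (hL.2.1 i _)
    · rw [inner_dilation]
      exact hL.2.2 _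
  refine (dualNorm_le hL').trans_eq ?_
  simp [vacuum, ← inner_dilation, dilation_monomial]

theorem tendsto_dilation {d : ℕ} (g : Hardy d) :
    Tendsto (fun r => dilation d r g) (𝓝 1) (𝓝 g) := by
  rw [tendsto_iff_norm_sub_tendsto_zero]
  have h1 : ∀ r : unitInterval, ‖dilation d r g - g‖ ^ 2
      = ∑' α : MultiIndex d, ‖(((r : ℝ) : ℂ) ^ α.degree - 1) * g α‖ ^ 2 := by
    intro r
    rw [← (hardy_norm_sq _).tsum_eq]
    refine tsum_congr fun α => ?_
    rw [lp.coeFn_sub, Pi.sub_apply, dilation_apply, sub_mul, one_mul]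
  have h2 : Tendsto (fun r : unitInterval => ‖dilation d r g - g‖ ^ 2) (𝓝 1) (𝓝 0) := by
    simp only [h1]
    rw [show (0 : ℝ) = ∑' α : MultiIndex d, (0 : ℝ) by simp]
    -- Dominated convergence; the constant is `4 = 2²`, from `|r^n - 1| ≤ 2`.
    refine tendsto_tsum_of_dominated_convergence (bound := fun α => 4 * ‖g α‖ ^ 2)
      ((hardy_norm_sq g).summable.mul_left 4) (fun α => ?_) (Eventually.of_forall fun r α => ?_)
    · have : Continuous fun r : unitInterval => ‖(((r : ℝ) : ℂ) ^ α.degree - 1) * g α‖ ^ 2 := by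
        fun_prop
      simpa using this.tendsto 1
    · rw [norm_pow, norm_norm, norm_mul, mul_pow]
      have : ‖((r : ℝ) : ℂ) ^ α.degree - 1‖ ≤ 2 := by
        refine (norm_sub_le _ _).trans ?_
        have := pow_mem_unitInterval (r := r) α.degree
        rw [norm_one]
        linarith
      have h4 : ‖((r : ℝ) : ℂ) ^ α.degree - 1‖ ^ 2 ≤ 4 := by
        nlinarith [norm_nonneg (((r : ℝ) : ℂ) ^ α.degree - 1)]
      gcongr
  have h3 := h2.sqrt
  simpa [Real.sqrt_sq (norm_nonneg _)] using h3

/-! ### The Cauchy pairing is bounded by the product of the norms -/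

theorem exists_eq_adjoint_comp {H : Type*} [NormedAddCommGroup H] [InnerProductSpace ℂ H]
    [CompleteSpace H] {L : H →L[ℂ] H} (hL : 0 ≤ L) : ∃ S : H →L[ℂ] H, L = S.adjoint ∘L S :=
  CStarAlgebra.nonneg_iff_eq_star_mul_self.1 hL

/-- Functionals `g` on `H²` and the coordinate multiplications factor through the Hilbert space
completion of `H²` with respect to a form `L ∈ 𝓛_c(g)`. -/
theorem exists_hilbert_model {d : ℕ} {g : Hardy d} {L : Hardy d →L[ℂ] Hardy d}
    (hL : L ∈ coneLcAbove g) :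
    ∃ (K : Type) (_ : NormedAddCommGroup K) (_ : InnerProductSpace ℂ K) (_ : CompleteSpace K)
      (e : Hardy d →L[ℂ] K) (T : Fin d → K →L[ℂ] K) (φ : K →L[ℂ] ℂ),
      (∀ i j, Commute (T i) (T j)) ∧ (∀ i, ‖T i‖ ≤ 1) ∧ (∀ i u, T i (e u) = e (mulCoord i u)) ∧
      (∀ u, φ (e u) = inner ℂ g u) ∧ ‖φ‖ ≤ 1 ∧ ‖e (hardyMonomial 0)‖ = √(vacuum L) := by
  obtain ⟨S, hS⟩ := exists_eq_adjoint_comp hL.1.1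
  have hSL : ∀ u, inner ℂ u (L u) = ((‖S u‖ ^ 2 : ℝ) : ℂ) := by
    intro u
    rw [hS, ContinuousLinearMap.comp_apply, ContinuousLinearMap.adjoint_inner_right,
      inner_self_eq_norm_sq_to_K]
    push_cast
    rfl
  rw [mem_coneLcAbove_iff] at hL
  simp only [hSL] at hL
  -- Since `‖S u‖² = ⟨L u, u⟩`, the closed range of `S` is the completion of `H²` for the form `L`,
  -- with null vectors already divided out.
  let R : Submodule ℂ (Hardy d) := (LinearMap.range S.toLinearMap).topologicalClosure
  have hmem : ∀ u, S u ∈ R := fun u => Submodule.le_topologicalClosure _ ⟨u, rfl⟩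
  let e : Hardy d →L[ℂ] R := S.codRestrict R hmem
  have hne : ∀ u, ‖e u‖ = ‖S u‖ := fun u => rfl
  have hde : DenseRange e := by
    intro x
    rw [Topology.IsInducing.subtypeVal.closure_eq_preimage_closure_image]
    rw [← Set.range_comp]
    exact x.2
  -- The cone inequalities become `‖S (zᵢ u)‖ ≤ ‖S u‖` and `|⟨g, u⟩| ≤ ‖S u‖`, which make both maps
  -- well defined and contractive on the dense range of `e`.
  have hT : ∀ i u, ‖(e ∘L mulCoord i).toLinearMap u‖ ≤ 1 * ‖e.toLinearMap u‖ := by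
    intro i u
    have := hL.2.1 i u
    rw [one_mul]
    exact (sq_le_sq₀ (norm_nonneg _) (norm_nonneg _)).1 (by exact_mod_cast this)
  have hφ : ∀ u, ‖(innerSL ℂ g).toLinearMap u‖ ≤ 1 * ‖e.toLinearMap u‖ := by
    intro u
    have := hL.2.2 u
    rw [one_mul]
    exact (sq_le_sq₀ (norm_nonneg _) (norm_nonneg _)).1 (by exact_mod_cast this)
  let T : Fin d → R →L[ℂ] R := fun i => (e ∘L mulCoord i).toLinearMap.extendOfNorm e.toLinearMap
  have hTe : ∀ i u, T i (e u) = e (mulCoord i u) := fun i u =>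
    LinearMap.extendOfNorm_eq hde ⟨1, hT i⟩ u
  refine ⟨R, inferInstance, inferInstance,
    (Submodule.isClosed_topologicalClosure _).completeSpace_coe, e, T,
    (innerSL ℂ g).toLinearMap.extendOfNorm e.toLinearMap, fun i j => ?_, fun i => ?_, hTe,
    fun u => LinearMap.extendOfNorm_eq hde ⟨1, hφ⟩ u, ?_, ?_⟩
  · refine ContinuousLinearMap.ext fun x => congrFun (hde.equalizer (T i * T j).continuous
      (T j * T i).continuous (funext fun u => ?_)) x
    simp only [Function.comp_apply, mul_apply_eq_comp, hTe]
    congr 1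
    ext α
    change shiftCoeff i (shiftCoeff j u) α = shiftCoeff j (shiftCoeff i u) α
    by_cases hij : i = j
    · rw [hij]
    · simp only [shiftCoeff, Finsupp.tsub_apply, Finsupp.single_eq_of_ne hij,
        Finsupp.single_eq_of_ne (Ne.symm hij), tsub_zero]
      split_ifs <;> simp [tsub_right_comm]
  · exact LinearMap.opNorm_extendOfNorm_le hde zero_le_one (hT i)
  · exact LinearMap.opNorm_extendOfNorm_le hde zero_le_one hφ
  · rw [vacuum, hSL, Complex.ofReal_re, Real.sqrt_sq (norm_nonneg _), hne]

/-- The sum is the number `φ(f(rT) e(1))` in the Hilbert space model of any `L`; the factor `r < 1`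
makes the contractions strict. As sums are unique, its value does not depend on `L`, which permits
the infimum over `L`. -/
theorem norm_dilated_pairing_le {d : ℕ} {f : polydisc d → ℂ} (hf : IsHolomorphic f)
    (hfin : saNorm f < ∞) (g : Hardy d) {r : unitInterval} (hr : r < 1) :
    ∃ s, HasSum (fun α : MultiIndex d =>
      ((r : ℝ) : ℂ) ^ α.degree * (taylorCoeff f α * conj (g α))) s ∧
      ‖s‖ ≤ (saNorm f).toReal * dualNorm g := by
  have key : ∀ L ∈ coneLcAbove g, ∃ s, HasSum (fun α : MultiIndex d =>
      ((r : ℝ) : ℂ) ^ α.degree * (taylorCoeff f α * conj (g α))) s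
      ∧ ‖s‖ ≤ (saNorm f).toReal * √(vacuum L) := by
    intro L hL
    obtain ⟨K, _, _, _, e, T, φ, hcomm, hT, hTe, hφ, hφ1, he⟩ := exists_hilbert_model hL
    have hc : ∀ i j, Commute (((r : ℝ) : ℂ) • T i) (((r : ℝ) : ℂ) • T j) := fun i j =>
      ((hcomm i j).smul_left _).smul_right _
    have hs : ∀ i, ‖((r : ℝ) : ℂ) • T i‖ < 1 := by
      intro i
      rw [norm_smul, Complex.norm_real, Real.norm_of_nonneg r.2.1]
      exact mul_lt_one_of_nonneg_of_lt_one_left r.2.1 hr (hT i)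
    have h1 := (summable_opEval hf hs).hasSum
    have h2 := h1.mapL (φ ∘L ContinuousLinearMap.apply ℂ K (e (hardyMonomial 0)))
    have hm : ∀ α, opMonomial T α (e (hardyMonomial 0)) = e (hardyMonomial α) := by
      intro α
      induction α using MultiIndex.induction with
      | h0 => simp [opMonomial_zero]
      | h1 α i ih =>
        rw [opMonomial_add_single hcomm, mul_apply_eq_comp, ih, hTe, mulCoord_monomial]
    refine ⟨φ (opEval f (fun i => ((r : ℝ) : ℂ) • T i) (e (hardyMonomial 0))), ?_, ?_⟩
    · refine h2.congr_fun fun α => ?_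
      simp only [ContinuousLinearMap.comp_apply, ContinuousLinearMap.apply_apply,
        opMonomial_smul hcomm, hm, map_smul, hφ, inner_monomial_right, smul_eq_mul]
      ring
    · have h3 : ‖opEval f (fun i => ((r : ℝ) : ℂ) • T i)‖ ≤ (saNorm f).toReal := by
        have := ENNReal.toReal_mono hfin.ne (le_saNorm f K _ hc hs)
        rwa [toReal_enorm] at this
      calc _ ≤ 1 * (‖opEval f (fun i => ((r : ℝ) : ℂ) • T i)‖ * ‖e (hardyMonomial 0)‖) :=
            (φ.le_of_opNorm_le hφ1 _).trans (by gcongr; exact ContinuousLinearMap.le_opNorm _ _)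
        _ ≤ _ := by
            rw [one_mul, he]
            gcongr
  obtain ⟨L₀, hL₀⟩ := coneLcAbove_nonempty g
  obtain ⟨s, hs, -⟩ := key L₀ hL₀
  refine ⟨s, hs, ?_⟩
  -- Passing to the infimum divides by the Schur–Agler norm, so norm zero is treated separately.
  rcases (ENNReal.toReal_nonneg (a := saNorm f)).eq_or_lt with h0 | h0
  · obtain ⟨s', hs', hb⟩ := key L₀ hL₀
    rw [hs.unique hs']
    simpa [← h0] using hb
  · rw [← div_le_iff₀' h0]
    refine le_dualNorm fun L hL => ?_
    obtain ⟨s', hs', hb⟩ := key L hL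
    rw [hs.unique hs', div_le_iff₀' h0]
    exact hb

theorem dualNorm_le_norm {d : ℕ} (g : Hardy d) : dualNorm g ≤ ‖g‖ := by
  have h := dualNorm_le (g := g) ⟨smul_mem_coneLc (id_mem_coneLc d) (sq_nonneg ‖g‖), rankOne_le g⟩
  rw [vacuum_smul, vacuum, ContinuousLinearMap.id_apply, inner_self_eq_norm_sq_to_K,
    norm_hardyMonomial] at h
  simpa [Real.sqrt_sq (norm_nonneg g)] using h

instance nhdsLT_one_neBot : (𝓝[<] (1 : unitInterval)).NeBot :=
  nhdsLT_neBot_of_exists_lt ⟨0, zero_lt_one⟩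

theorem tendsto_coe_pow {n : ℕ} :
    Tendsto (fun r : unitInterval => ((r : ℝ) : ℂ) ^ n) (𝓝[<] 1) (𝓝 1) := by
  have : Continuous fun r : unitInterval => ((r : ℝ) : ℂ) ^ n := by fun_prop
  simpa using (this.tendsto 1).mono_left nhdsWithin_le_nhds

/-- Schur–Agler functions belong to the Hardy space. -/
theorem memℓp_taylorCoeff {d : ℕ} {f : polydisc d → ℂ} (hf : IsHolomorphic f)
    (hfin : saNorm f < ∞) : Memℓp (taylorCoeff f) 2 := by
  set C := (saNorm f).toReal
  refine memℓp_gen' (C := C ^ 2) fun s => ?_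
  -- Testing against the truncated Taylor series of `f` itself gives `‖g‖² ≤ C ‖g‖`, hence a bound
  -- on the partial sums of squares that is uniform in `s`.
  let g : Hardy d := ∑ α ∈ s, lp.single 2 α (taylorCoeff f α)
  have hg : ∀ α, g α = if α ∈ s then taylorCoeff f α else 0 := by
    intro α
    simp only [g, lp.coeFn_sum, Finset.sum_apply, lp.single_apply, Pi.single_apply]
    simp
  have hgn : ‖g‖ ^ 2 = ∑ α ∈ s, ‖taylorCoeff f α‖ ^ 2 := by
    have h := lp.norm_sum_single (p := 2) (by simp) (taylorCoeff f) s
    simpa [g] using h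
  have hle : ∑ α ∈ s, ‖taylorCoeff f α‖ ^ 2 ≤ C * ‖g‖ := by
    have ht : Tendsto (fun r : unitInterval =>
        ‖∑ α ∈ s, ((r : ℝ) : ℂ) ^ α.degree * (taylorCoeff f α * conj (g α))‖) (𝓝[<] 1)
        (𝓝 ‖∑ α ∈ s, 1 * (taylorCoeff f α * conj (g α))‖) :=
      (tendsto_finsetSum _ fun α _ => tendsto_coe_pow.mul_const _).norm
    have hval : ‖∑ α ∈ s, 1 * (taylorCoeff f α * conj (g α))‖
        = ∑ α ∈ s, ‖taylorCoeff f α‖ ^ 2 := by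
      have : ∑ α ∈ s, 1 * (taylorCoeff f α * conj (g α))
          = ((∑ α ∈ s, ‖taylorCoeff f α‖ ^ 2 : ℝ) : ℂ) := by
        push_cast
        refine Finset.sum_congr rfl fun α hα => ?_
        rw [hg, if_pos hα, one_mul, Complex.mul_conj']
      rw [this, Complex.norm_real, Real.norm_of_nonneg (by positivity)]
    rw [hval] at ht
    refine le_of_tendsto ht (eventually_mem_nhdsWithin.mono fun r hr => ?_)
    obtain ⟨t, h1, h2⟩ := norm_dilated_pairing_le hf hfin g hr
    have h3 : HasSum (fun α : MultiIndex d =>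
        ((r : ℝ) : ℂ) ^ α.degree * (taylorCoeff f α * conj (g α)))
        (∑ α ∈ s, ((r : ℝ) : ℂ) ^ α.degree * (taylorCoeff f α * conj (g α))) :=
      hasSum_sum_of_ne_finset_zero fun α hα => by simp [hg, hα]
    rw [h3.unique h1]
    exact h2.trans (mul_le_mul_of_nonneg_left (dualNorm_le_norm g) ENNReal.toReal_nonneg)
  have hgC : ‖g‖ ≤ C := by
    rcases (norm_nonneg g).eq_or_lt with h0 | h0
    · rw [← h0]
      exact ENNReal.toReal_nonneg
    · rw [← hgn, sq] at hle
      exact le_of_mul_le_mul_right hle h0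
  simp only [ENNReal.toReal_ofNat, Real.rpow_ofNat]
  rw [← hgn]
  exact pow_le_pow_left₀ (norm_nonneg _) hgC 2

/-- Square summability makes the undilated pairing an inner product, so strong convergence of the
dilations lets `r → 1` in `norm_dilated_pairing_le`. -/
theorem norm_inner_taylorCoeff_le {d : ℕ} {f : polydisc d → ℂ} (hf : IsHolomorphic f)
    (hfin : saNorm f < ∞) (g : Hardy d) :
    ‖inner ℂ (⟨taylorCoeff f, memℓp_taylorCoeff hf hfin⟩ : Hardy d) g‖
      ≤ (saNorm f).toReal * dualNorm g := by
  set h : Hardy d := ⟨taylorCoeff f, memℓp_taylorCoeff hf hfin⟩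
  rw [norm_inner_symm]
  have ht : Tendsto (fun r => ‖inner ℂ g (dilation d r h)‖) (𝓝[<] 1) (𝓝 ‖inner ℂ g h‖) :=
    (((innerSL ℂ g).continuous.tendsto h).comp
      ((tendsto_dilation h).mono_left nhdsWithin_le_nhds)).norm
  refine le_of_tendsto ht (eventually_mem_nhdsWithin.mono fun r hr => ?_)
  obtain ⟨t, h1, h2⟩ := norm_dilated_pairing_le hf hfin g hr
  have h3 := lp.hasSum_inner (𝕜 := ℂ) g (dilation d r h)
  rw [h3.unique (h1.congr_fun fun α => ?_)]
  · exact h2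
  · rw [RCLike.inner_apply, dilation_apply, mul_assoc]

/-! ### Functionals bounded in the dual norm come from Schur–Agler functions -/

theorem hardy_clm_ext {d : ℕ} {F : Type*} [NormedAddCommGroup F] [NormedSpace ℂ F]
    {A B : Hardy d →L[ℂ] F} (h : ∀ α, A (hardyMonomial α) = B (hardyMonomial α)) : A = B := by
  refine ContinuousLinearMap.ext fun u => ?_
  refine ((hasSum_hardyMonomial u).mapL A).unique (((hasSum_hardyMonomial u).mapL B).congr_fun ?_)
  intro α
  rw [map_smul, map_smul, h]

theorem norm_hardy_apply_le {d : ℕ} (u : Hardy d) (α : MultiIndex d) : ‖u α‖ ≤ ‖u‖ :=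
  lp.norm_apply_le_norm (by simp) u α

section Orbit

variable {d : ℕ} {H : Type} [NormedAddCommGroup H] [InnerProductSpace ℂ H]

/-- The sup norm of the vector of operator norms serves as bound, including when there are no
variables. -/
theorem exists_norm_le_lt_one {T : Fin d → H →L[ℂ] H} (hT : ∀ i, ‖T i‖ < 1) :
    ∃ ρ : ℝ, 0 ≤ ρ ∧ ρ < 1 ∧ ∀ i, ‖T i‖ ≤ ρ :=
  ⟨‖fun i => ‖T i‖‖, norm_nonneg _, (pi_norm_lt_iff zero_lt_one).2 fun i => by simpa using hT i,
    fun i => by simpa using norm_le_pi_norm (fun i => ‖T i‖) i⟩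

/-- The operator `u ↦ u(T) x` from the Hardy space to `H`. -/
theorem exists_orbit_map [CompleteSpace H] {T : Fin d → H →L[ℂ] H} (hT : ∀ i, ‖T i‖ < 1) (x : H) :
    ∃ A : Hardy d →L[ℂ] H, ∀ u, HasSum (fun α => u α • opMonomial T α x) (A u) := by
  obtain ⟨ρ, h0, h1, hρ⟩ := exists_norm_le_lt_one hT
  have hs := summable_pow_degree (d := d) h0 h1
  have hb : ∀ (u : Hardy d) α, ‖u α • opMonomial T α x‖ ≤ (‖u‖ * ‖x‖) * ρ ^ α.degree := by
    intro u α
    rw [norm_smul, mul_assoc, mul_comm ‖x‖]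
    refine mul_le_mul (norm_hardy_apply_le u α) ?_ (norm_nonneg _) (norm_nonneg _)
    exact (opMonomial T α).le_of_opNorm_le (norm_opMonomial_le_pow hρ α) x
  have hsum : ∀ u : Hardy d, HasSum (fun α => u α • opMonomial T α x)
      (∑' α, u α • opMonomial T α x) := fun u =>
    (Summable.of_norm_bounded (hs.mul_left _) (hb u)).hasSum
  refine ⟨LinearMap.mkContinuous
    { toFun := fun u => ∑' α, u α • opMonomial T α x
      map_add' := fun u v => ?_
      map_smul' := fun c u => ?_ } (‖x‖ * ∑' α : MultiIndex d, ρ ^ α.degree) fun u => ?_, hsum⟩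
  · rw [← ((hsum u).add (hsum v)).tsum_eq]
    exact tsum_congr fun α => add_smul _ _ _
  · exact (tsum_congr fun α => mul_smul c (u α) _).trans ((hsum u).const_smul c).tsum_eq
  · refine (tsum_of_norm_bounded (hs.hasSum.mul_left _) (hb u)).trans_eq ?_
    ring

end Orbit

/-- The hypothesis is tested on one vector per tuple and per `x`: with the orbit map `A u = u(T) x`
and `y = A h = f(T) x`, take `g = A* y`, for which `⟨h, g⟩ = ‖y‖²`. -/
theorem saNorm_le_of_norm_inner_le {d : ℕ} {h : Hardy d} {C : ℝ} (hC : 0 ≤ C)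
    (hb : ∀ g, ‖inner ℂ h g‖ ≤ C * dualNorm g) {f : polydisc d → ℂ} (hf : HasTaylor h f) :
    saNorm f ≤ ENNReal.ofReal C := by
  have hhol : IsHolomorphic f := by
    convert isHolomorphic_of_bounded (norm_hardy_apply_le h) using 1
    exact funext fun z => (hf z).tsum_eq.symm
  refine saNorm_le fun H _ _ _ T hc hT => ?_
  rw [← ofReal_norm]
  refine ENNReal.ofReal_le_ofReal (ContinuousLinearMap.opNorm_le_bound _ hC fun x => ?_)
  obtain ⟨A, hA⟩ := exists_orbit_map hT x
  have hAm : ∀ α, A (hardyMonomial α) = opMonomial T α x := by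
    intro α
    refine (hA _).unique ?_
    convert hasSum_single α fun β hβ => ?_ using 1
    · simp [hardyMonomial]
    · simp [hardyMonomial, hβ]
  have hAM : ∀ i u, A (mulCoord i u) = T i (A u) := by
    intro i u
    refine congrArg (fun B : Hardy d →L[ℂ] H => B u)
      (hardy_clm_ext (A := A ∘L mulCoord i) (B := T i ∘L A) fun α => ?_)
    rw [ContinuousLinearMap.comp_apply, ContinuousLinearMap.comp_apply, mulCoord_monomial, hAm, hAm,
      opMonomial_add_single hc, mul_apply_eq_comp]
  have hAh : A h = opEval f T x := by
    refine (hA h).unique ?_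
    have h1 := (summable_opEval hhol hT).hasSum.mapL (ContinuousLinearMap.apply ℂ H x)
    rw [opEval]
    rw [hf.taylorCoeff_eq] at h1 ⊢
    exact h1
  rw [← hAh]
  set y := A h
  have hA2 : ∀ u, inner ℂ u ((A.adjoint ∘L A) u) = ((‖A u‖ ^ 2 : ℝ) : ℂ) := by
    intro u
    rw [ContinuousLinearMap.comp_apply, ContinuousLinearMap.adjoint_inner_right,
      inner_self_eq_norm_sq_to_K]
    push_cast
    rfl
  -- Membership in the cone holds because `A` intertwines multiplication by `zᵢ` with the
  -- contraction `T i`; domination of the rank one operator is Cauchy–Schwarz for `⟨y, A u⟩`.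
  have hL : ((‖y‖ ^ 2 : ℝ) : ℂ) • (A.adjoint ∘L A) ∈ coneLcAbove (A.adjoint y) := by
    rw [mem_coneLcAbove_iff]
    simp only [smul_apply, inner_smul_right, hA2, ContinuousLinearMap.adjoint_inner_left, hAM,
      ← Complex.ofReal_mul, Complex.real_le_real]
    refine ⟨fun u => by exact_mod_cast (by positivity), fun i u => ?_, fun u => ?_⟩
    · gcongr
      exact (T i).le_of_opNorm_le_of_le (hT i).le le_rfl |>.trans_eq (one_mul _)
    · rw [← mul_pow]
      gcongr
      exact norm_inner_le_norm _ _
  -- The vacuum value is `‖y‖² ‖x‖²`, as `A` sends the constant `1` to `x`.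
  have hd : dualNorm (A.adjoint y) ≤ ‖y‖ * ‖x‖ := by
    refine (dualNorm_le hL).trans_eq ?_
    rw [vacuum_smul, vacuum, hA2, hAm, opMonomial_zero, Complex.ofReal_re, ← mul_pow,
      Real.sqrt_sq (by positivity)]
    rfl
  have h2 : ‖y‖ ^ 2 ≤ C * (‖y‖ * ‖x‖) := by
    have h3 := (hb (A.adjoint y)).trans (mul_le_mul_of_nonneg_left hd hC)
    rw [ContinuousLinearMap.adjoint_inner_right, inner_self_eq_norm_sq_to_K, norm_pow] at h3
    simpa using h3
  rcases (norm_nonneg y).eq_or_lt with h0 | h0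
  · rw [← h0]
    positivity
  · refine le_of_mul_le_mul_right ?_ h0
    linarith

/-! ### Operators and functionals on the predual -/

theorem norm_toPredual {d : ℕ} (g : Hardy d) : ‖toPredual g‖ = dualNorm g :=
  UniformSpace.Completion.norm_coe (E := HardyStar d) g

/-- The canonical map of the Hardy space into the predual as a bounded operator. -/
def toPredualL (d : ℕ) : Hardy d →L[ℂ] Predual d :=
  LinearMap.mkContinuous
    { toFun := toPredual
      map_add' := fun g h => UniformSpace.Completion.coe_add (α := HardyStar d) g h
      map_smul' := fun c g => UniformSpace.Completion.coe_smul (X := HardyStar d) c g }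
    1 fun g => by
      rw [one_mul]
      exact (norm_toPredual g).trans_le (dualNorm_le_norm g)

theorem toPredualL_apply {d : ℕ} (g : Hardy d) : toPredualL d g = toPredual g := rfl

theorem denseRange_toPredualL (d : ℕ) : DenseRange (toPredualL d) :=
  UniformSpace.Completion.denseRange_coe (α := HardyStar d)

section Extend

variable {d : ℕ} {F : Type*} [NormedAddCommGroup F] [NormedSpace ℂ F] [CompleteSpace F]

/-- The extension to the predual of an operator on `H²` which is bounded for `‖·‖_*`. -/
def extendPredual (A : Hardy d →L[ℂ] F) : Predual d →L[ℂ] F :=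
  A.toLinearMap.extendOfNorm (toPredualL d).toLinearMap

theorem extendPredual_apply {A : Hardy d →L[ℂ] F} {C : ℝ} (h : ∀ g, ‖A g‖ ≤ C * dualNorm g)
    (g : Hardy d) : extendPredual A (toPredual g) = A g :=
  LinearMap.extendOfNorm_eq (denseRange_toPredualL d)
    ⟨C, fun g => (h g).trans_eq (by rw [← norm_toPredual]; rfl)⟩ g

theorem norm_extendPredual_le {A : Hardy d →L[ℂ] F} {C : ℝ} (hC : 0 ≤ C)
    (h : ∀ g, ‖A g‖ ≤ C * dualNorm g) : ‖extendPredual A‖ ≤ C :=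
  LinearMap.opNorm_extendOfNorm_le (denseRange_toPredualL d) hC
    fun g => (h g).trans_eq (by rw [← norm_toPredual]; rfl)

omit [CompleteSpace F] in
theorem predual_clm_ext {A B : Predual d →L[ℂ] F} (h : ∀ g, A (toPredual g) = B (toPredual g)) :
    A = B :=
  ContinuousLinearMap.ext fun x => congrFun ((denseRange_toPredualL d).equalizer A.continuous
    B.continuous (funext h)) x

end Extend

/-- The `α`-th Taylor coefficient as a functional on the predual. -/
def coeffL {d : ℕ} (α : MultiIndex d) : Predual d →L[ℂ] ℂ :=
  extendPredual (innerSL ℂ (hardyMonomial α))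

theorem norm_inner_monomial_le {d : ℕ} (α : MultiIndex d) (g : Hardy d) :
    ‖innerSL ℂ (hardyMonomial α) g‖ ≤ 1 * dualNorm g := by
  rw [innerSL_apply_apply, inner_monomial_left, one_mul]
  exact norm_coeff_le_dualNorm g α

theorem coeffL_toPredual {d : ℕ} (α : MultiIndex d) (g : Hardy d) :
    coeffL α (toPredual g) = g α :=
  (extendPredual_apply (norm_inner_monomial_le α) g).trans (inner_monomial_left α g)

theorem norm_coeffL_le {d : ℕ} (α : MultiIndex d) : ‖coeffL (d := d) α‖ ≤ 1 :=
  norm_extendPredual_le zero_le_one (norm_inner_monomial_le α)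

theorem norm_coeffL_apply_le {d : ℕ} (x : Predual d) (α : MultiIndex d) :
    ‖coeffL α x‖ ≤ ‖x‖ := by
  simpa using (coeffL α).le_of_opNorm_le (norm_coeffL_le α) x

/-- The dilation `x ↦ x(r ·)` of the predual. -/
def predualDilation (d : ℕ) (r : unitInterval) : Predual d →L[ℂ] Predual d :=
  extendPredual (toPredualL d ∘L dilation d r)

theorem norm_toPredual_dilation_le {d : ℕ} (r : unitInterval) (g : Hardy d) :
    ‖(toPredualL d ∘L dilation d r) g‖ ≤ 1 * dualNorm g := by
  rw [one_mul]
  exact (norm_toPredual _).trans_le (dualNorm_dilation_le r g)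

theorem predualDilation_toPredual {d : ℕ} (r : unitInterval) (g : Hardy d) :
    predualDilation d r (toPredual g) = toPredual (dilation d r g) :=
  extendPredual_apply (norm_toPredual_dilation_le r) g

theorem norm_predualDilation_le {d : ℕ} (r : unitInterval) : ‖predualDilation d r‖ ≤ 1 :=
  norm_extendPredual_le zero_le_one (norm_toPredual_dilation_le r)

/-- Strong convergence holds on the dense image of `H²` and passes to the completion because the
dilations are uniformly contractive. -/
theorem tendsto_predualDilation {d : ℕ} (x : Predual d) :
    Tendsto (fun r => predualDilation d r x) (𝓝[<] 1) (𝓝 x) := by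
  rw [Metric.tendsto_nhds]
  intro ε hε
  obtain ⟨g, hg⟩ := (denseRange_toPredualL d).exists_dist_lt x (ε := ε / 3) (by positivity)
  have h1 : Tendsto (fun r => toPredualL d (dilation d r g)) (𝓝[<] 1) (𝓝 (toPredualL d g)) :=
    (((toPredualL d).continuous.tendsto g).comp (tendsto_dilation g)).mono_left nhdsWithin_le_nhds
  filter_upwards [Metric.tendsto_nhds.1 h1 (ε / 3) (by positivity)] with r hr
  have h2 : dist (predualDilation d r x) (toPredualL d (dilation d r g)) ≤
      dist x (toPredualL d g) := by
    rw [toPredualL_apply, ← predualDilation_toPredual, dist_eq_norm, dist_eq_norm, ← map_sub]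
    exact ((predualDilation d r).le_of_opNorm_le (norm_predualDilation_le r) _).trans_eq
      (one_mul _)
  have h3 := dist_triangle4 (predualDilation d r x) (toPredualL d (dilation d r g))
    (toPredualL d g) x
  rw [dist_comm (toPredualL d g) x] at h3
  linarith

theorem norm_toPredual_monomial_le {d : ℕ} (α : MultiIndex d) :
    ‖toPredual (hardyMonomial α)‖ ≤ 1 :=
  (norm_toPredual _).trans_le ((dualNorm_le_norm _).trans_eq (norm_hardyMonomial α))

/-- For `r < 1` the rank one operators `x ↦ r^|α| x_α z^α` are absolutely summable in operator norm;
their sum agrees with the dilation on the dense image of `H²`. -/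
theorem hasSum_predualDilation {d : ℕ} {r : unitInterval} (hr : r < 1) (x : Predual d) :
    HasSum (fun α => (((r : ℝ) : ℂ) ^ α.degree * coeffL α x) • toPredual (hardyMonomial α))
      (predualDilation d r x) := by
  have hs : Summable fun α : MultiIndex d => ((r : ℝ) : ℂ) ^ α.degree •
      (coeffL α).smulRight (toPredual (hardyMonomial α)) := by
    refine Summable.of_norm_bounded (summable_pow_degree (d := d) r.2.1 hr) fun α => ?_
    rw [norm_smul, norm_pow, Complex.norm_real, Real.norm_of_nonneg r.2.1,
      ContinuousLinearMap.norm_smulRight_apply]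
    exact mul_le_of_le_one_right (pow_nonneg r.2.1 _)
      (mul_le_one₀ (norm_coeffL_le α) (norm_nonneg _) (norm_toPredual_monomial_le α))
  have happ : ∀ y, HasSum
      (fun α => (((r : ℝ) : ℂ) ^ α.degree * coeffL α y) • toPredual (hardyMonomial α))
      ((∑' α : MultiIndex d, ((r : ℝ) : ℂ) ^ α.degree •
        (coeffL α).smulRight (toPredual (hardyMonomial α))) y) := fun y => by
    have := hs.hasSum.mapL (ContinuousLinearMap.apply ℂ (Predual d) y)
    simpa [smul_smul] using this
  have heq : (∑' α : MultiIndex d, ((r : ℝ) : ℂ) ^ α.degree •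
      (coeffL α).smulRight (toPredual (hardyMonomial α))) = predualDilation d r := by
    refine predual_clm_ext fun g => (happ _).unique ?_
    rw [predualDilation_toPredual]
    have := (hasSum_hardyMonomial (dilation d r g)).mapL (toPredualL d)
    refine this.congr_fun fun α => ?_
    rw [coeffL_toPredual, map_smul, dilation_apply]
    rfl
  rw [← heq]
  exact happ x

/-- A completion could acquire nonzero elements with no coefficients. Here such an `x` has vanishing
dilates for all `r < 1`, and these converge to `x`. -/
theorem eq_zero_of_coeffL {d : ℕ} {x : Predual d} (h : ∀ α, coeffL α x = 0) : x = 0 := by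
  refine tendsto_nhds_unique (tendsto_predualDilation x)
    (tendsto_const_nhds.congr' (eventually_mem_nhdsWithin.mono fun r hr => ?_))
  refine HasSum.unique ?_ (hasSum_predualDilation hr x)
  simp [h, hasSum_zero]

/-! ### The predual as a space of functions -/

/-- The elements of the predual as functions on the polydisc. -/
def predualFun (d : ℕ) : Predual d →ₗ[ℂ] (polydisc d → ℂ) where
  toFun x z := ∑' α, coeffL α x * ∏ i, (z : Fin d → ℂ) i ^ α i
  map_add' x y := funext fun z => by
    have h := (hasTaylor_of_bounded (norm_coeffL_apply_le x) z).add
      (hasTaylor_of_bounded (norm_coeffL_apply_le y) z)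
    rw [Pi.add_apply, ← h.tsum_eq]
    exact tsum_congr fun α => by rw [map_add, add_mul]
  map_smul' c x := funext fun z => by
    have h := (hasTaylor_of_bounded (norm_coeffL_apply_le x) z).mul_left c
    rw [RingHom.id_apply, Pi.smul_apply, smul_eq_mul, ← h.tsum_eq]
    exact tsum_congr fun α => by rw [map_smul, smul_eq_mul, mul_assoc]

theorem hasTaylor_predualFun {d : ℕ} (x : Predual d) :
    HasTaylor (fun α => coeffL α x) (predualFun d x) :=
  hasTaylor_of_bounded (norm_coeffL_apply_le x)

theorem hasTaylor_predualFun_toPredual {d : ℕ} (g : Hardy d) :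
    HasTaylor g (predualFun d (toPredual g)) := by
  simpa only [coeffL_toPredual] using hasTaylor_predualFun (toPredual g)

theorem predualFun_injective (d : ℕ) : Function.Injective (predualFun d) := by
  rw [← LinearMap.ker_eq_bot, LinearMap.ker_eq_bot']
  intro x hx
  have h := hasTaylor_predualFun x
  rw [hx] at h
  exact eq_zero_of_coeffL (congrFun h.eq_zero)

theorem continuous_predualFun {d : ℕ} (z : polydisc d) :
    Continuous fun x => predualFun d x z := by
  refine AddMonoidHomClass.continuous_of_bound ((LinearMap.proj z).comp (predualFun d))
    (∑' α : MultiIndex d, ‖∏ i, z.1 i ^ α i‖) fun x => ?_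
  rw [mul_comm]
  refine tsum_of_norm_bounded ((hasSum_prod_pow z.1 z.2).1.hasSum.mul_left ‖x‖) fun α => ?_
  rw [norm_mul]
  gcongr
  exact norm_coeffL_apply_le x α

theorem HasTaylor.eq {d : ℕ} {a : MultiIndex d → ℂ} {f g : polydisc d → ℂ} (hf : HasTaylor a f)
    (hg : HasTaylor a g) : f = g :=
  funext fun z => (hf z).unique (hg z)

/-! ### Polynomials and kernel functions in the predual -/

/-- The monomial function `z^α` on the polydisc. -/
def monomialFun {d : ℕ} (α : MultiIndex d) : polydisc d → ℂ := fun z => ∏ i, z.1 i ^ α i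

theorem hasTaylor_monomialFun {d : ℕ} (α : MultiIndex d) :
    HasTaylor (hardyMonomial α) (monomialFun α) := by
  intro z
  convert hasSum_single α fun β hβ => ?_ using 1
  · simp [hardyMonomial, monomialFun]
  · simp [hardyMonomial, hβ]

theorem polyFunctions_eq_span (d : ℕ) :
    polyFunctions d = Submodule.span ℂ (Set.range monomialFun) := by
  refine le_antisymm ?_ (Submodule.span_le.2 ?_)
  · rintro f ⟨p, hp⟩
    have : f = ∑ α ∈ p.support, p.coeff α • monomialFun α := by
      ext z
      rw [hp, MvPolynomial.eval_eq']
      simp [monomialFun]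
    rw [this]
    exact Submodule.sum_mem _ fun α _ => Submodule.smul_mem _ _ (Submodule.subset_span ⟨α, rfl⟩)
  · rintro _ ⟨α, rfl⟩
    refine ⟨MvPolynomial.monomial α 1, fun z => ?_⟩
    rw [MvPolynomial.eval_monomial, one_mul, Finsupp.prod_fintype _ _ fun i => pow_zero _]
    rfl

theorem predualFun_monomial {d : ℕ} (α : MultiIndex d) :
    predualFun d (toPredual (hardyMonomial α)) = monomialFun α :=
  (hasTaylor_predualFun_toPredual _).eq (hasTaylor_monomialFun α)

theorem memℓp_kernel {d : ℕ} (z : polydisc d) :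
    Memℓp (fun α : MultiIndex d => ∏ i, conj (z.1 i) ^ α i) 2 := by
  have h : Memℓp (fun α : MultiIndex d => ∏ i, conj (z.1 i) ^ α i) 1 :=
    memℓp_gen (by simpa using (hasSum_prod_pow z.1 z.2).1)
  exact h.of_exponent_ge one_le_two

/-- The kernel function `K_z` as an element of the Hardy space. -/
def hardyKernel {d : ℕ} (z : polydisc d) : Hardy d :=
  ⟨fun α => ∏ i, conj (z.1 i) ^ α i, memℓp_kernel z⟩

theorem predualFun_kernel {d : ℕ} (z : polydisc d) :
    predualFun d (toPredual (hardyKernel z)) = szegoKernel z :=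
  (hasTaylor_predualFun_toPredual _).eq (hasTaylor_szegoKernel z)

theorem inner_kernel {d : ℕ} {g : Hardy d} {f : polydisc d → ℂ} (hf : HasTaylor g f)
    (z : polydisc d) : inner ℂ (hardyKernel z) g = f z := by
  refine (lp.hasSum_inner (hardyKernel z) g).unique ((hf z).congr_fun fun α => ?_)
  rw [RCLike.inner_apply]
  simp [hardyKernel]

/-- The map of `H²` into the predual is continuous with dense range, so density may be tested in
`H²`, where it is triviality of the orthogonal complement. -/
theorem dense_of_orthogonal_eq_zero {d : ℕ} {N : Submodule ℂ (Predual d)} {ι : Type*}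
    {v : ι → Hardy d} (hv : ∀ i, toPredual (v i) ∈ N)
    (h0 : ∀ g : Hardy d, (∀ i, inner ℂ (v i) g = 0) → g = 0) : Dense (N : Set (Predual d)) := by
  have h1 : Dense (N.comap (toPredualL d).toLinearMap : Set (Hardy d)) := by
    rw [Submodule.dense_iff_topologicalClosure_eq_top, Submodule.topologicalClosure_eq_top_iff,
      Submodule.eq_bot_iff]
    intro g hg
    exact h0 g fun i => (Submodule.mem_orthogonal _ _).1 hg _ (hv i)
  refine ((denseRange_toPredualL d).dense_image (toPredualL d).continuous h1).mono ?_
  rintro _ ⟨g, hg, rfl⟩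
  exact hg

theorem eq_zero_of_inner_monomial {d : ℕ} {g : Hardy d}
    (h : ∀ α, inner ℂ (hardyMonomial α) g = 0) : g = 0 :=
  lp.ext (funext fun α => (inner_monomial_left α g).symm.trans (h α))

/-- By the reproducing property the function of `g` vanishes identically, and Taylor coefficients
are unique. -/
theorem eq_zero_of_inner_kernel {d : ℕ} {g : Hardy d}
    (h : ∀ z : polydisc d, inner ℂ (hardyKernel z) g = 0) : g = 0 := by
  have h1 := hasTaylor_of_bounded (norm_hardy_apply_le g)
  have h2 : HasTaylor g (0 : polydisc d → ℂ) := by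
    convert h1 using 1
    exact funext fun z => ((inner_kernel h1 z).symm.trans (h z)).symm
  exact lp.ext h2.eq_zero

/-! ### The duality -/

/-- A Schur–Agler function as an element of the Hardy space. -/
def SchurAgler.toHardy {d : ℕ} (f : SchurAgler d) : Hardy d :=
  ⟨taylorCoeff f, memℓp_taylorCoeff f.2.1 f.2.2⟩

theorem SchurAgler.toHardy_add {d : ℕ} (f g : SchurAgler d) :
    (f + g).toHardy = f.toHardy + g.toHardy :=
  lp.ext (f.2.1.hasTaylor.add g.2.1.hasTaylor).taylorCoeff_eq

theorem SchurAgler.toHardy_smul {d : ℕ} (c : ℂ) (f : SchurAgler d) :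
    (c • f).toHardy = c • f.toHardy :=
  lp.ext (f.2.1.hasTaylor.smul c).taylorCoeff_eq

theorem SchurAgler.norm_inner_le {d : ℕ} (f : SchurAgler d) (g : Hardy d) :
    ‖innerSL ℂ f.toHardy g‖ ≤ ‖f‖ * dualNorm g :=
  norm_inner_taylorCoeff_le f.2.1 f.2.2 g

/-- The functional `⟨·, f⟩` on the predual. -/
def cauchyFunctional {d : ℕ} (f : SchurAgler d) : StrongDual ℂ (Predual d) :=
  extendPredual (innerSL ℂ f.toHardy)

theorem cauchyFunctional_toPredual {d : ℕ} (f : SchurAgler d) (g : Hardy d) :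
    cauchyFunctional f (toPredual g) = inner ℂ f.toHardy g :=
  extendPredual_apply f.norm_inner_le g

theorem norm_le_of_inner_le {d : ℕ} (f : SchurAgler d) {C : ℝ} (hC : 0 ≤ C)
    (h : ∀ g, ‖inner ℂ f.toHardy g‖ ≤ C * dualNorm g) : ‖f‖ ≤ C :=
  ENNReal.toReal_le_of_le_ofReal hC (saNorm_le_of_norm_inner_le hC h f.2.1.hasTaylor)

theorem norm_cauchyFunctional {d : ℕ} (f : SchurAgler d) : ‖cauchyFunctional f‖ = ‖f‖ := by
  refine le_antisymm (norm_extendPredual_le (norm_nonneg f) f.norm_inner_le)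
    (norm_le_of_inner_le f (norm_nonneg _) fun g => ?_)
  rw [← cauchyFunctional_toPredual, ← norm_toPredual]
  exact ContinuousLinearMap.le_opNorm _ _

/-- Riesz representation of the functional pulled back to `H²` gives `h`; the `‖·‖_*`-bound then
makes the function with coefficients `h` Schur–Agler. -/
theorem cauchyFunctional_surjective (d : ℕ) : Function.Surjective (cauchyFunctional (d := d)) := by
  intro ℓ
  let h : Hardy d := (InnerProductSpace.toDual ℂ (Hardy d)).symm (ℓ ∘L toPredualL d)
  have hin : ∀ g, inner ℂ h g = ℓ (toPredual g) := fun g =>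
    InnerProductSpace.toDual_symm_apply
  have hT := hasTaylor_of_bounded (norm_hardy_apply_le h)
  have hb : ∀ g, ‖inner ℂ h g‖ ≤ ‖ℓ‖ * dualNorm g := fun g => by
    rw [hin, ← norm_toPredual]
    exact ℓ.le_opNorm _
  let f : SchurAgler d := ⟨_, isHolomorphic_of_bounded (norm_hardy_apply_le h),
    (saNorm_le_of_norm_inner_le (norm_nonneg ℓ) hb hT).trans_lt ENNReal.ofReal_lt_top⟩
  have hf : f.toHardy = h := lp.ext hT.taylorCoeff_eq
  refine ⟨f, predual_clm_ext fun g => ?_⟩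
  rw [cauchyFunctional_toPredual, hf, hin]

/-- The conjugate linear isometric isomorphism of the Schur–Agler space onto the dual of the
predual, given by the Cauchy pairing. -/
def cauchyDuality (d : ℕ) : SchurAgler d ≃ₗᵢ⋆[ℂ] StrongDual ℂ (Predual d) :=
  LinearIsometryEquiv.ofSurjective
    { toFun := cauchyFunctional
      map_add' := fun f g => predual_clm_ext fun u => by
        rw [add_apply]
        simp only [cauchyFunctional_toPredual, SchurAgler.toHardy_add, inner_add_left]
      map_smul' := fun c f => predual_clm_ext fun u => by
        rw [smul_apply]
        simp only [cauchyFunctional_toPredual, SchurAgler.toHardy_smul, inner_smul_left,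
          smul_eq_mul]
      norm_map' := norm_cauchyFunctional }
    (cauchyFunctional_surjective d)

theorem cauchyDuality_toPredual {d : ℕ} (f : SchurAgler d) (g : Hardy d) :
    cauchyDuality d f (toPredual g) = inner ℂ f.toHardy g :=
  cauchyFunctional_toPredual f g

theorem cauchyDuality_kernel {d : ℕ} (f : SchurAgler d) (z : polydisc d) :
    cauchyDuality d f (toPredual (hardyKernel z)) = conj (f z) := by
  refine (cauchyDuality_toPredual f _).trans ((inner_conj_symm _ _).symm.trans ?_)
  exact congrArg conj (inner_kernel (g := f.toHardy) f.2.1.hasTaylor z)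

/-! ### Weak-star topologies -/

section WeakStar

variable {d : ℕ} {X Y : Type*} [NormedAddCommGroup X] [NormedSpace ℂ X]
  [NormedAddCommGroup Y] [NormedSpace ℂ Y]

theorem continuous_weakStar_apply (Ψ : SchurAgler d → StrongDual ℂ X) (x : X) :
    @Continuous _ _ (weakStarTopology Ψ) inferInstance fun f => Ψ f x :=
  let := weakStarTopology Ψ
  (WeakDual.eval_continuous (𝕜 := ℂ) x).comp continuous_induced_dom

theorem le_weakStar_iff {τ : TopologicalSpace (SchurAgler d)}
    {Ψ : SchurAgler d → StrongDual ℂ X} :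
    τ ≤ weakStarTopology Ψ ↔ ∀ x, @Continuous _ _ τ inferInstance fun f => Ψ f x := by
  constructor
  · exact fun h x => continuous_le_dom h (continuous_weakStar_apply Ψ x)
  · intro h
    rw [← continuous_iff_le_induced]
    exact WeakDual.continuous_of_continuous_eval h

theorem weakStar_le_of_forall_exists {Ψ : SchurAgler d → StrongDual ℂ X}
    {Φ : SchurAgler d → StrongDual ℂ Y} {σ : ℂ → ℂ} (hσ : Continuous σ)
    (h : ∀ y, ∃ x, ∀ f, Φ f y = σ (Ψ f x)) : weakStarTopology Ψ ≤ weakStarTopology Φ := by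
  rw [le_weakStar_iff]
  intro y
  obtain ⟨x, hx⟩ := h y
  simp only [hx]
  let := weakStarTopology Ψ
  exact hσ.comp (continuous_weakStar_apply Ψ x)

/-- If every functional `f ↦ Ψ f x` with `x` in a total set is represented by an element of the
complete space `Y`, then this is so for all `x`. -/
theorem exists_representation {E : Type*} [CompleteSpace Y] {Ψ : E → StrongDual ℂ X}
    {Φ : E → StrongDual ℂ Y} {σ τ : ℂ →+* ℂ} (hσ : ∀ w, ‖σ w‖ = ‖w‖)
    (hστ : ∀ w, σ (τ w) = w) {C : ℝ} (hC : 0 ≤ C)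
    (hΦ : ∀ ℓ : StrongDual ℂ Y, ∃ f, Φ f = ℓ ∧ ‖Ψ f‖ ≤ C * ‖ℓ‖) {D : Set X}
    (hD : Dense (Submodule.span ℂ D : Set X))
    (h : ∀ x ∈ D, ∃ y, ∀ f, Ψ f x = σ (Φ f y)) (x : X) : ∃ y, ∀ f, Ψ f x = σ (Φ f y) := by
  have hσc : Continuous σ := (AddMonoidHomClass.isometry_of_norm σ hσ).continuous
  let S : Submodule ℂ X :=
    { carrier := {x | ∃ y, ∀ f, Ψ f x = σ (Φ f y)}
      zero_mem' := ⟨0, fun f => by simp⟩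
      add_mem' := by
        rintro a b ⟨y, hy⟩ ⟨z, hz⟩
        exact ⟨y + z, fun f => by simp [hy, hz]⟩
      smul_mem' := by
        rintro c a ⟨y, hy⟩
        exact ⟨τ c • y, fun f => by simp [hy, hστ]⟩ }
  -- Hahn–Banach supplies `ℓ` norming `y`; realizing it as `Φ f` bounds `y` by `x`. Hence
  -- representers of a convergent sequence are Cauchy, and the representable vectors form a closed
  -- subspace.
  have hnorm : ∀ {x y}, (∀ f, Ψ f x = σ (Φ f y)) → ‖y‖ ≤ C * ‖x‖ := by
    intro x y hxy
    obtain ⟨ℓ, hℓ, hy⟩ := exists_dual_vector'' ℂ y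
    obtain ⟨f, hf, hb⟩ := hΦ ℓ
    have h1 : ‖Ψ f x‖ = ‖y‖ := by
      rw [hxy, hσ, hf, hy]
      simp
    rw [← h1]
    exact (Ψ f).le_of_opNorm_le (hb.trans (mul_le_of_le_one_right hC hℓ)) x
  have hS : IsClosed (S : Set X) := by
    refine isSeqClosed_iff_isClosed.1 fun u x hu hx => ?_
    choose y hy using hu
    have hy' : CauchySeq y := by
      rw [cauchySeq_iff_tendsto_dist_atTop_0]
      have h0 := (cauchySeq_iff_tendsto_dist_atTop_0.1 hx.cauchySeq).const_mul C
      rw [mul_zero] at h0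
      refine squeeze_zero (fun _ => dist_nonneg) (fun n => ?_) h0
      rw [dist_eq_norm, dist_eq_norm]
      exact hnorm fun f => by rw [map_sub, map_sub, map_sub, hy, hy]
    obtain ⟨y₀, hy₀⟩ := cauchySeq_tendsto_of_complete hy'
    refine ⟨y₀, fun f => tendsto_nhds_unique (((Ψ f).continuous.tendsto x).comp hx) ?_⟩
    refine ((hσc.tendsto _).comp (((Φ f).continuous.tendsto y₀).comp hy₀)).congr fun n => ?_
    exact (hy n f).symm
  have hDS : Submodule.span ℂ D ≤ S := Submodule.span_le.2 h
  exact closure_minimal hDS hS (hD x)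

/-- A family of vectors is total if no nonzero functional vanishes on it. -/
theorem dense_span_of_forall_dual {D : Set X}
    (h : ∀ ℓ : StrongDual ℂ X, (∀ x ∈ D, ℓ x = 0) → ℓ = 0) :
    Dense (Submodule.span ℂ D : Set X) := by
  rw [Submodule.dense_iff_topologicalClosure_eq_top, Submodule.eq_top_iff']
  intro x
  set N := (Submodule.span ℂ D).topologicalClosure with hN
  have : IsClosed (N : Set X) := Submodule.isClosed_topologicalClosure _
  by_contra hx
  have hx' : N.mkQ x ≠ 0 := by simpa using hx
  obtain ⟨ℓ, -, hℓ⟩ := exists_dual_vector ℂ (N.mkQ x) (norm_ne_zero_iff.2 hx')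
  have h0 := h (ℓ ∘L N.mkQL) fun y hy => by
    have : N.mkQ y = 0 := by
      simpa using Submodule.le_topologicalClosure _ (Submodule.subset_span hy)
    exact (congrArg ℓ this).trans (map_zero ℓ)
  have h1 : ℓ (N.mkQ x) = 0 := congrArg (fun A : StrongDual ℂ X => A x) h0
  rw [hℓ] at h1
  exact hx' (norm_eq_zero.1 (Complex.ofReal_eq_zero.1 h1))

/-! ### Point evaluations and uniqueness of the weak-star topology. -/

theorem dense_span_kernel (d : ℕ) :
    Dense (Submodule.span ℂ (Set.range fun z : polydisc d => toPredual (hardyKernel z)) :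
      Set (Predual d)) :=
  dense_of_orthogonal_eq_zero (fun z => Submodule.subset_span ⟨z, rfl⟩)
    fun _ => eq_zero_of_inner_kernel

theorem evalContinuous_cauchyDuality (d : ℕ) :
    EvalContinuous (weakStarTopology (cauchyDuality d)) := by
  intro z
  have h : (fun f : SchurAgler d => f z)
      = fun f => conj (cauchyDuality d f (toPredual (hardyKernel z))) := by
    funext f
    rw [cauchyDuality_kernel, Complex.conj_conj]
  rw [h]
  let := weakStarTopology (cauchyDuality d)
  exact Complex.continuous_conj.comp (continuous_weakStar_apply _ _)

theorem weakDual_exists_eval (φ : WeakDual ℂ X →L[ℂ] ℂ) : ∃ x, ∀ w : WeakDual ℂ X, φ w = w x := by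
  obtain ⟨x, hx⟩ := LinearMap.dualEmbedding_surjective (topDualPairing ℂ X) φ
  exact ⟨x, fun w => by rw [← hx]; rfl⟩

/-- The inverse pair `σ`, `τ` treats the linear and the conjugate linear case at once. -/
theorem weakStarTopology_unique {σ τ : ℂ →+* ℂ} [RingHomInvPair σ τ] [RingHomInvPair τ σ]
    [RingHomIsometric σ] [RingHomIsometric τ] [CompleteSpace X]
    (Ψ : SchurAgler d ≃SL[σ] StrongDual ℂ X) (hΨ : EvalContinuous (weakStarTopology Ψ)) :
    weakStarTopology Ψ = weakStarTopology (cauchyDuality d) := by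
  have hτσ : ∀ w, τ (σ w) = w := fun w => RingHomInvPair.comp_apply_eq
  have hστ : ∀ w, σ (τ w) = w := fun w => RingHomInvPair.comp_apply_eq₂
  have hσn : ∀ w, ‖σ w‖ = ‖w‖ := fun w => RingHomIsometric.norm_map
  have hτn : ∀ w, ‖τ w‖ = ‖w‖ := fun w => RingHomIsometric.norm_map
  have hσc : Continuous σ := (AddMonoidHomClass.isometry_of_norm σ hσn).continuous
  have hx : ∀ z : polydisc d, ∃ x, ∀ f, Ψ f x = σ (f z) := by
    intro z
    -- Evaluation at `z` transported to `X^*`; the outer `σ` undoes the `τ`-semilinearity of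
    -- `Ψ.symm`. Being weak-star continuous and linear, it is given by a vector of `X`.
    let φ : WeakDual ℂ X →L[ℂ] ℂ :=
      { toFun := fun w => σ (Ψ.symm (WeakDual.toStrongDual w) z)
        map_add' := fun v w => by
          rw [map_add, map_add Ψ.symm]
          exact map_add σ _ _
        map_smul' := fun c w => by
          rw [map_smul, map_smulₛₗ, RingHom.id_apply, smul_eq_mul]
          nth_rewrite 2 [← hστ c]
          rw [← map_mul]
          rfl
        cont := by
          let := weakStarTopology Ψ
          refine hσc.comp ((hΨ z).comp (continuous_induced_rng.2 ?_))
          convert continuous_id using 1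
          funext w
          simp }
    obtain ⟨x, hx⟩ := weakDual_exists_eval φ
    refine ⟨x, fun f => ?_⟩
    have := hx (StrongDual.toWeakDual (Ψ f))
    rw [StrongDual.toWeakDual_apply] at this
    rw [← this]
    change σ (Ψ.symm (Ψ f) z) = _
    rw [Ψ.symm_apply_apply]
  choose v hv using hx
  -- A functional killing every `v z` is `Ψ f` for an `f` vanishing on the whole polydisc.
  have hdense : Dense (Submodule.span ℂ (Set.range v) : Set X) := by
    refine dense_span_of_forall_dual fun ℓ hℓ => ?_
    obtain ⟨f, rfl⟩ := Ψ.surjective ℓ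
    have : f = 0 := Subtype.ext (funext fun z => by
      have h1 := hℓ _ ⟨z, rfl⟩
      rw [hv, ← map_zero σ] at h1
      exact σ.injective h1)
    rw [this, map_zero]
  obtain ⟨C, hC, hΨC⟩ := SemilinearMapClass.bound_of_continuous Ψ Ψ.continuous
  obtain ⟨C', hC', hΨC'⟩ := SemilinearMapClass.bound_of_continuous Ψ.symm Ψ.symm.continuous
  -- Both directions match `v z` with `K_z`: the first pairs with `f` to `σ (f z)`, the second to
  -- the conjugate of `f z`, which accounts for the composed ring homomorphisms.
  refine le_antisymm ?_ ?_
  · refine weakStar_le_of_forall_exists (σ := (starRingEnd ℂ).comp τ)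
      (Complex.continuous_conj.comp (AddMonoidHomClass.isometry_of_norm τ hτn).continuous) ?_
    refine exists_representation (τ := σ.comp (starRingEnd ℂ)) (C := C') (fun w => by simp [hτn])
      (fun w => by simp [hτσ]) hC'.le (fun ℓ => ⟨Ψ.symm ℓ, Ψ.apply_symm_apply ℓ, ?_⟩)
      (dense_span_kernel d) ?_
    · exact ((cauchyDuality d).norm_map _).trans_le (hΨC' ℓ)
    · rintro _ ⟨z, rfl⟩
      exact ⟨v z, fun f => by rw [hv, cauchyDuality_kernel, RingHom.comp_apply, hτσ]⟩
  · refine weakStar_le_of_forall_exists (σ := σ.comp (starRingEnd ℂ))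
      (hσc.comp Complex.continuous_conj) ?_
    refine exists_representation (τ := (starRingEnd ℂ).comp τ) (C := C) (fun w => by simp [hσn])
      (fun w => by simp [hστ]) hC.le
      (fun ℓ => ⟨(cauchyDuality d).symm ℓ, (cauchyDuality d).apply_symm_apply ℓ, ?_⟩)
      hdense ?_
    · exact (hΨC _).trans_eq (by rw [LinearIsometryEquiv.norm_map])
    · rintro _ ⟨z, rfl⟩
      exact ⟨toPredual (hardyKernel z), fun f => by
        rw [hv, cauchyDuality_kernel, RingHom.comp_apply, Complex.conj_conj]⟩

/-- On a bounded set each functional of the predual is a uniform limit of functionals from the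
kernel span, and those are continuous for pointwise convergence. -/
theorem weakStar_eq_pointwise_on_bounded {B : Set (SchurAgler d)} (hB : Bornology.IsBounded B) :
    (weakStarTopology (cauchyDuality d)).induced ((↑) : B → SchurAgler d) =
      (pointwiseTopology d).induced ((↑) : B → SchurAgler d) := by
  refine le_antisymm (induced_mono ?_) ?_
  · rw [← continuous_iff_le_induced]
    let := weakStarTopology (cauchyDuality d)
    exact continuous_pi (evalContinuous_cauchyDuality d)
  · let : TopologicalSpace B := (pointwiseTopology d).induced ((↑) : B → SchurAgler d)
    have heval : ∀ z : polydisc d, Continuous fun f : B => (f : SchurAgler d) z := fun z => by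
      let := pointwiseTopology d
      have h1 : Continuous fun f : SchurAgler d => f z :=
        (continuous_apply z).comp (continuous_induced_dom (f := fun (f : SchurAgler d)
          (z : polydisc d) => f z))
      exact h1.comp continuous_induced_dom
    obtain ⟨M, hM0, hM⟩ := hB.exists_pos_norm_le
    let S : Submodule ℂ (Predual d) :=
      { carrier := {y | Continuous fun f : B => cauchyDuality d f y}
        zero_mem' := by simpa using continuous_const
        add_mem' := fun {a b} ha hb => by
          simp only [Set.mem_ofPred_eq, map_add] at *
          exact ha.add hb
        smul_mem' := fun c a ha => by
          simp only [Set.mem_ofPred_eq, map_smul] at *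
          exact ha.const_smul c }
    have hker : Submodule.span ℂ (Set.range fun z : polydisc d => toPredual (hardyKernel z))
        ≤ S := by
      refine Submodule.span_le.2 ?_
      rintro _ ⟨z, rfl⟩
      change Continuous fun f : B => cauchyDuality d f (toPredual (hardyKernel z))
      simp only [cauchyDuality_kernel]
      exact Complex.continuous_conj.comp (heval z)
    suffices hc : Continuous fun f : B => StrongDual.toWeakDual (cauchyDuality d f) from
      (continuous_iff_le_induced.1 hc).trans_eq
        (induced_compose (f := ((↑) : B → SchurAgler d))
          (g := fun f => StrongDual.toWeakDual (cauchyDuality d f))).symm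
    refine WeakDual.continuous_of_continuous_eval fun y => ?_
    change Continuous fun f : B => cauchyDuality d f y
    refine continuous_of_uniform_approx_of_continuous fun u hu => ?_
    obtain ⟨ε, hε, hεu⟩ := Metric.mem_uniformity_dist.1 hu
    -- The tolerance `ε / M` compensates for the norm bound `M` on the elements of `B`.
    obtain ⟨y', hy', hyy'⟩ := Metric.mem_closure_iff.1 (dense_span_kernel d y) (ε / M)
      (by positivity)
    refine ⟨fun f : B => cauchyDuality d f y', hker hy', fun f => hεu ?_⟩
    change dist (cauchyDuality d f y) (cauchyDuality d f y') < ε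
    rw [dist_eq_norm, ← map_sub]
    refine ((cauchyDuality d f).le_of_opNorm_le
      (((cauchyDuality d).norm_map _).trans_le (hM f f.2)) _).trans_lt ?_
    rw [dist_eq_norm, lt_div_iff₀' hM0] at hyy'
    exact hyy'

/-! ### Polynomials in the Schur–Agler space and their weak-star density. -/

/-- The coefficient estimate `|g_α| ≤ ‖g‖_*` is, by duality, the bound `‖z^α‖_SA ≤ 1`. -/
theorem monomialFun_mem (α : MultiIndex d) : monomialFun α ∈ schurAglerSubmodule d := by
  refine ⟨?_, (saNorm_le_of_norm_inner_le zero_le_one (norm_inner_monomial_le α)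
    (hasTaylor_monomialFun α)).trans_lt ENNReal.ofReal_lt_top⟩
  have h := hasTaylor_of_bounded (norm_hardy_apply_le (hardyMonomial α))
  rw [(hasTaylor_monomialFun α).eq h]
  exact isHolomorphic_of_bounded (norm_hardy_apply_le (hardyMonomial α))

theorem polyFunctions_le (d : ℕ) : polyFunctions d ≤ schurAglerSubmodule d := by
  rw [polyFunctions_eq_span, Submodule.span_le]
  rintro _ ⟨α, rfl⟩
  exact monomialFun_mem α

/-- The monomial `z^α` as an element of the Schur–Agler space. -/
def schurAglerMonomial (α : MultiIndex d) : SchurAgler d := ⟨monomialFun α, monomialFun_mem α⟩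

theorem cauchyDuality_monomial (α : MultiIndex d) :
    cauchyDuality d (schurAglerMonomial α) = coeffL α := by
  refine predual_clm_ext fun g => ?_
  rw [cauchyDuality_toPredual, coeffL_toPredual, ← inner_monomial_left]
  congr 1
  exact lp.ext (hasTaylor_monomialFun α).taylorCoeff_eq

theorem tendsto_weakStar_iff {ι : Type*} {l : Filter ι} {u : ι → SchurAgler d} {f : SchurAgler d}
    {Ψ : SchurAgler d → StrongDual ℂ X} :
    Tendsto u l (@nhds _ (weakStarTopology Ψ) f) ↔
      ∀ x, Tendsto (fun i => Ψ (u i) x) l (𝓝 (Ψ f x)) := by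
  rw [nhds_induced, tendsto_comap_iff, tendsto_iff_forall_eval_tendsto_topDualPairing]
  rfl

theorem dense_polynomials_weakStar (d : ℕ) : @Dense _ (weakStarTopology (cauchyDuality d))
    {f : SchurAgler d | (f : polydisc d → ℂ) ∈ polyFunctions d} := by
  let := weakStarTopology (cauchyDuality d)
  intro f
  -- Two successive limits: `f` is approximated by dilates, and each dilate by its Taylor
  -- polynomials.
  rw [← closure_closure]
  -- The dilate `f(r ·)`, obtained as the image of `f` under the adjoint of the predual dilation, so
  -- membership in the Schur–Agler space is automatic.
  let u : unitInterval → SchurAgler d := fun r =>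
    (cauchyDuality d).symm (cauchyDuality d f ∘L predualDilation d r)
  have hu : ∀ r x, cauchyDuality d (u r) x = cauchyDuality d f (predualDilation d r x) :=
    fun r x => by rw [LinearIsometryEquiv.apply_symm_apply]; rfl
  refine mem_closure_of_tendsto (f := u) (b := 𝓝[<] 1) (tendsto_weakStar_iff.2 fun x => ?_)
    (eventually_mem_nhdsWithin.mono fun r hr => ?_)
  · simp only [hu]
    exact ((cauchyDuality d f).continuous.tendsto x).comp (tendsto_predualDilation x)
  · let c : MultiIndex d → ℂ := fun α => ((r : ℝ) : ℂ) ^ α.degree * taylorCoeff f α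
    refine mem_closure_of_tendsto (b := atTop) (f := fun s : Finset (MultiIndex d) =>
      ∑ α ∈ s, c α • schurAglerMonomial α) (tendsto_weakStar_iff.2 fun x => ?_)
      (Eventually.of_forall fun s => ?_)
    · rw [hu]
      refine ((hasSum_predualDilation hr x).mapL (cauchyDuality d f)).congr fun s => ?_
      rw [map_sum, sum_apply]
      refine Finset.sum_congr rfl fun α _ => ?_
      beta_reduce
      rw [map_smulₛₗ (cauchyDuality d), smul_apply, cauchyDuality_monomial, map_smul,
        cauchyDuality_toPredual, inner_monomial_right]
      simp only [c, map_mul, map_pow, Complex.conj_ofReal, smul_eq_mul]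
      rw [show f.toHardy α = taylorCoeff f α from rfl]
      ring
    · have hsum : ∀ s : Finset (MultiIndex d), ((∑ α ∈ s, c α • schurAglerMonomial α :
          SchurAgler d) : polydisc d → ℂ) = ∑ α ∈ s, c α • monomialFun α := fun s =>
        map_sum (schurAglerSubmodule d).subtype (fun α => c α • schurAglerMonomial α) s
      change _ ∈ polyFunctions d
      rw [hsum, polyFunctions_eq_span]
      exact Submodule.sum_mem _ fun α _ => Submodule.smul_mem _ _ (Submodule.subset_span ⟨α, rfl⟩)

end WeakStar

end

end SchurAglerDual

/-! ### The main theorem. -/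

theorem mainTheorem8 (d : ℕ) :
    ∃ (J : Predual d →ₗ[ℂ] (polydisc d → ℂ))
      (Φ : SchurAgler d ≃ₗᵢ⋆[ℂ] StrongDual ℂ (Predual d)),
      -- `J` realizes elements of the completion as functions, extending the inclusion of `H²`
      (∀ g : Hardy d, HasTaylor g (J (toPredual g))) ∧
      -- `Φ` is the duality given by the Cauchy pairing `⟨g, f⟩ = ∑ g_α conj(f_α)`
      (∀ (f : SchurAgler d) (g : Hardy d),
        HasSum (fun α => g α * conj (taylorCoeff f α)) (Φ f (toPredual g))) ∧
      -- (a) Banach space of analytic functions with continuous point evaluations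
      (CompleteSpace (Predual d) ∧ Function.Injective J ∧ (∀ x, IsHolomorphic (J x)) ∧
        ∀ z, Continuous fun x => J x z) ∧
      -- (b) polynomials and linear combinations of kernel functions are dense
      (polyFunctions d ≤ LinearMap.range J ∧
        Dense ((polyFunctions d).comap J : Set (Predual d)) ∧
        kernelSpan d ≤ LinearMap.range J ∧
        Dense ((kernelSpan d).comap J : Set (Predual d))) ∧
      -- (c) the weak-star topology has continuous point evaluations, and is the only such one
      (EvalContinuous (weakStarTopology Φ) ∧
        (∀ (X : Type*) [NormedAddCommGroup X] [NormedSpace ℂ X] [CompleteSpace X],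
          (∀ Ψ : SchurAgler d ≃L⋆[ℂ] StrongDual ℂ X,
            EvalContinuous (weakStarTopology Ψ) → weakStarTopology Ψ = weakStarTopology Φ) ∧
          (∀ Ψ : SchurAgler d ≃L[ℂ] StrongDual ℂ X,
            EvalContinuous (weakStarTopology Ψ) → weakStarTopology Ψ = weakStarTopology Φ)) ∧
        -- on bounded sets it is the topology of pointwise convergence
        ∀ B : Set (SchurAgler d), Bornology.IsBounded B →
          (weakStarTopology Φ).induced ((↑) : B → SchurAgler d) =
            (pointwiseTopology d).induced ((↑) : B → SchurAgler d)) ∧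
      -- (d) the polynomials are weak-star dense in the Schur–Agler space
      (polyFunctions d ≤ schurAglerSubmodule d ∧
        @Dense _ (weakStarTopology Φ) {f : SchurAgler d | (f : polydisc d → ℂ) ∈
          polyFunctions d}) := by
  refine ⟨predualFun d, cauchyDuality d, hasTaylor_predualFun_toPredual, fun f g => ?_,
    ⟨inferInstance, predualFun_injective d, fun x =>
      isHolomorphic_of_bounded (norm_coeffL_apply_le x),
      continuous_predualFun⟩, ⟨?_, ?_, ?_, ?_⟩,
    ⟨evalContinuous_cauchyDuality d, fun X _ _ _ => ⟨fun Ψ h => weakStarTopology_unique Ψ h,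
      fun Ψ h => weakStarTopology_unique Ψ h⟩, fun B hB => weakStar_eq_pointwise_on_bounded hB⟩,
    polyFunctions_le d, dense_polynomials_weakStar d⟩
  · rw [cauchyDuality_toPredual]
    exact lp.hasSum_inner f.toHardy g
  · rw [polyFunctions_eq_span, Submodule.span_le]
    rintro _ ⟨α, rfl⟩
    exact ⟨_, predualFun_monomial α⟩
  · refine dense_of_orthogonal_eq_zero (v := hardyMonomial) (fun α => ?_)
      fun _ => eq_zero_of_inner_monomial
    rw [Submodule.mem_comap, predualFun_monomial, polyFunctions_eq_span]
    exact Submodule.subset_span ⟨α, rfl⟩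
  · rw [kernelSpan, Submodule.span_le]
    rintro _ ⟨z, rfl⟩
    exact ⟨_, predualFun_kernel z⟩
  · refine dense_of_orthogonal_eq_zero (v := hardyKernel) (fun z => ?_)
      fun _ => eq_zero_of_inner_kernel
    rw [Submodule.mem_comap, predualFun_kernel]
    exact Submodule.subset_span ⟨z, rfl⟩
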